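/- For $n\ge 0$ let $\Pi(n)$ be the set of set partitions of $[n]=\{1,\dots,n\}$. For $\lambda\in\Pi(n)$ write $i\sim_\lambda j$ if $i,j$ lie in the same block of $\lambda$; let $\mathbf{First}(\lambda)$ (resp. $\mathbf{Last}(\lambda)$) be the set of smallest (resp. largest) elements of blocks of $\lambda$, and let $\mathbf{Arc}(\lambda)$ be the set of pairs $(i,j)$ such that $j$ is the smallest element greater than $i$ in the block of $i$. A pattern $\underline P=(P,\mathbf F,\mathbf L,\mathbf A,\mathbf C)$ of length $k\ge 0$ consists of a set partition $P$ of $[k]$ and subsets $\mathbf F,\mathbf L\subseteq[k]$, $\mathbf A,\mathbf C\subseteq[k]\times[k]$. An occurrence of $\underline P$ in $\lambda\in\Pi(n)$, written $s\in_{\underline P}\lambda$, is a tuple $s=(x_1,\dots,x_k)\in[n]^k$ with $x_1<\dots<x_k$; $x_i\sim_\lambda x_j$ if and only if $i\sim_P j$; $x_i\in\mathbf{First}(\lambda)$ for $i\in\mathbf F$; $x_i\in\mathbf{Last}(\lambda)$ for $i\in\mathbf L$; $(x_i,x_j)\in\mathbf{Arc}(\lambda)$ for $(i,j)\in\mathbf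 A$; and $|x_i-x_j|=1$ for $(i,j)\in\mathbf C$. For $Q\in\mathbb Z[y_1,\dots,y_k,m]$ the simple statistic $f_{\underline P,Q}$ is $$f_{\underline P,Q}(\lambda)=\sum_{(x_1,\dots,x_k)\in_{\underline P}\lambda}Q(x_1,\dots,x_k,n)\qquad(\lambda\in\Pi(n)),$$ and its degree is $k+\deg Q$ (with $\deg 0=0$). A statistic is a function $f:\bigcup_{n\ge0}\Pi(n)\to\mathbb Q$ that is a finite $\mathbb Q$-linear combination of simple statistics; its degree is the minimum, over all such representations of $f$, of the maximal degree of a simple statistic that appears (the maximum over an empty combination being $0$). Let $B_m$ be the $m$-th Bell number for $m\ge 0$, and put $B_m=0$ for $m<0$. **Theorem 2.2.** Let $f$ be a statistic of degree $N$, and let $k$ be the maximal length of a pattern that appears in some given representation of $f$ as a finite $\mathbb Q$-linear combination of simple statistics ($k=0$ for the empty combination). Then there are polynomials $Q_j\in\mathbb Q[x]$, $-k\le j\le N$, such that $$M(f;n):=\sum_{\lambda\in\Pi(n)}f(\lambda)=\sum_{-k\le j\le N}Q_j(n)\,B_{n+j}\qquad\text{for all } n\ge\max(1,k-1),$$ and,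 for every integer $0\le j\le N+k$, the coefficient $Q_{N-j}$ of $B_{n+N-j}$ has degree at most $j$ if $j\le N$ and at most $j-1$ if $j>N$. (The number $B_{-1}$ can occur only for $n=k-1$.) -/

import Mathlib

open Finset

namespace SetPartitionStat

/-- Set partitions of `[n]`. The element `i : Fin n` stands for the integer `i + 1 ∈ [n]`. -/
abbrev SetPartition (n : ℕ) : Type := Finpartition (univ : Finset (Fin n))

/-- `i ∼ j`: the elements `i` and `j` lie in the same block. -/
def Rel {n : ℕ} (l : SetPartition n) (i j : Fin n) : Prop :=
  ∃ b ∈ l.parts, i ∈ b ∧ j ∈ b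

/-- `i` is the smallest element of its block. -/
def IsFirst {n : ℕ} (l : SetPartition n) (i : Fin n) : Prop :=
  ∀ j, Rel l i j → i ≤ j

/-- `i` is the largest element of its block. -/
def IsLast {n : ℕ} (l : SetPartition n) (i : Fin n) : Prop :=
  ∀ j, Rel l i j → j ≤ i

/-- `(i, j)` is an arc: `j` is the smallest element of the block of `i` that is greater
than `i`. -/
def IsArc {n : ℕ} (l : SetPartition n) (i j : Fin n) : Prop :=
  Rel l i j ∧ i < j ∧ ∀ h, Rel l i h → i < h → j ≤ h

/-- A pattern of length `k`: a set partition of `[k]`, together with subsets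
`F, L ⊆ [k]` and `A, C ⊆ [k] × [k]`. -/
structure Pattern (k : ℕ) where
  partition : SetPartition k
  firsts : Finset (Fin k)
  lasts : Finset (Fin k)
  arcs : Finset (Fin k × Fin k)
  consec : Finset (Fin k × Fin k)

/-- `s = (x_1, …, x_k)` is an occurrence of the pattern `P` in the set partition `l`. -/
structure IsOccurrence {k n : ℕ} (P : Pattern k) (l : SetPartition n) (s : Fin k → Fin n) :
    Prop where
  strictMono : StrictMono s
  rel_iff : ∀ i j, Rel l (s i) (s j) ↔ Rel P.partition i j
  isFirst : ∀ i ∈ P.firsts, IsFirst l (s i)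
  isLast : ∀ i ∈ P.lasts, IsLast l (s i)
  isArc : ∀ p ∈ P.arcs, IsArc l (s p.1) (s p.2)
  consec : ∀ p ∈ P.consec, |((s p.1 : ℕ) : ℤ) - ((s p.2 : ℕ) : ℤ)| = 1

/-- The data of a simple statistic: a pattern of length `k` and a polynomial
`Q ∈ ℤ[y_1, …, y_k, m]`. The variable `some i` is `y_i`, the variable `none` is `m`. -/
structure SimpleStatistic where
  length : ℕ
  pattern : Pattern length
  poly : MvPolynomial (Option (Fin length)) ℤ

open Classical in
/-- The value `f_{P,Q}(l) = ∑_{s ∈_P l} Q(s)`, where `Q(s)` is `Q` at `y_i = x_i`, `m = n`. -/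
noncomputable def SimpleStatistic.value (σ : SimpleStatistic) {n : ℕ} (l : SetPartition n) : ℤ :=
  ∑ s : Fin σ.length → Fin n with IsOccurrence σ.pattern l s,
    MvPolynomial.eval (fun v : Option (Fin σ.length) =>
      v.elim (n : ℤ) (fun i => ((s i : ℕ) : ℤ) + 1)) σ.poly

/-- The degree of a simple statistic: the length of its pattern plus the degree of `Q`. -/
noncomputable def SimpleStatistic.degree (σ : SimpleStatistic) : ℕ :=
  σ.length + σ.poly.totalDegree

/-- The finite `ℚ`-linear combination `c` of simple statistics represents the function `f` on
all set partitions. -/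
def Represents (c : SimpleStatistic →₀ ℚ) (f : (n : ℕ) → SetPartition n → ℚ) : Prop :=
  ∀ (n : ℕ) (l : SetPartition n), f n l = c.sum fun σ a => a * (σ.value l : ℚ)

/-- The largest degree of a simple statistic that appears in the linear combination `c`. -/
noncomputable def maxDegree (c : SimpleStatistic →₀ ℚ) : ℕ :=
  c.support.sup SimpleStatistic.degree

/-- The largest length of a pattern that appears in the linear combination `c`. -/
noncomputable def maxLength (c : SimpleStatistic →₀ ℚ) : ℕ :=
  c.support.sup SimpleStatistic.length

/-- The degree of a statistic `f`: the minimum of `maxDegree c` over all representations `c`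
of `f`. -/
noncomputable def degree (f : (n : ℕ) → SetPartition n → ℚ) : ℕ :=
  sInf {d | ∃ c : SimpleStatistic →₀ ℚ, Represents c f ∧ maxDegree c = d}

/-- The aggregate `M(f; n) = ∑_{l ∈ Π(n)} f(l)`. -/
def aggregate (f : (n : ℕ) → SetPartition n → ℚ) (n : ℕ) : ℚ :=
  ∑ l : SetPartition n, f n l

/-- The Bell number `B_m`, with the convention `B_m = 0` for `m < 0`. -/
def bellNumber (m : ℤ) : ℚ :=
  if 0 ≤ m then (Nat.bell m.toNat : ℚ) else 0

/-- A shifted Bell polynomial `∑_j Q_j(n) B_{n+j}`, given by its finitely supported family of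
coefficient polynomials `Q_j ∈ ℚ[x]`, `j ∈ ℤ`. -/
abbrev ShiftedBellPolynomial : Type := ℤ →₀ Polynomial ℚ

/-- The value `R(n) = ∑_j Q_j(n) B_{n+j}`. -/
noncomputable def evalAt (R : ShiftedBellPolynomial) (n : ℕ) : ℚ :=
  R.sum fun j q => q.eval (n : ℚ) * bellNumber ((n : ℤ) + j)

end SetPartitionStat

/-!
Let `L` be the umbral functional `X ^ n ↦ B_n`. It satisfies `L((X)_b q(X)) = L(q(X + b))` for the
falling factorial `(X)_b`, in particular `L((X)_b) = 1`. A set partition with `b` blocks is the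
kernel of `(m)_b` colorings of `[n]` with `m` colors, so if the number of colorings whose kernel
has a certain property is a polynomial `g(m)`, then `L(g)` is the number of partitions with that
property.

Fix an increasing tuple `x` and count the colorings whose kernel has an occurrence of the pattern
at `x`. The entries of `x` are colored in `(m)_ℓ` ways, where `ℓ` is the number of blocks of the
pattern, and a point between two consecutive entries has `m - b` choices, or none, where `b ≤ ℓ`
depends only on the gap. The generating function in `n` of the sum over all `x` is therefore
built from the geometric series `1 / (1 - (X - b) T)`. Its coefficients are combinations of terms
`C(n - c, s) (X - b) ^ (n - i)`, which `L((X)_ℓ ·)` turns into polynomials in `n` times Bell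
numbers.

The degree bounds come from a representation of minimal degree and the bound on the shifts from
the given one. The two agree because `∑ Q_j(n) B_{n+j}` determines the `Q_j`: modulo a prime `p`,
Touchard's congruence makes the largest ideal in the kernel of `L` stable under `X ↦ X + 1`, and a
nonzero polynomial of degree less than `p` never lies in this ideal.
-/

namespace SetPartitionStat

open Polynomial
open scoped PowerSeries

section BellFunctional

variable (R : Type*) [CommRing R]

/-- The umbral functional `X ^ n ↦ B_n`. -/
noncomputable def bellFunctional : R[X] →ₗ[R] R :=
  lsum fun n => (Nat.bell n : R) • LinearMap.id

variable {R}

lemma bellFunctional_monomial (n : ℕ) (a : R) :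
    bellFunctional R (monomial n a) = Nat.bell n * a := by
  simp [bellFunctional, lsum_apply, sum_monomial_index]

lemma bellFunctional_X_pow (n : ℕ) : bellFunctional R (X ^ n) = Nat.bell n := by
  rw [X_pow_eq_monomial, bellFunctional_monomial, mul_one]

lemma bellFunctional_one : bellFunctional R 1 = 1 := by
  simpa using bellFunctional_X_pow (R := R) 0

lemma bellFunctional_C_mul (a : R) (q : R[X]) :
    bellFunctional R (C a * q) = a * bellFunctional R q := by
  rw [← smul_eq_C_mul, map_smul, smul_eq_mul]

lemma bell_succ_eq_sum_range (n : ℕ) :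
    Nat.bell (n + 1) = ∑ i ∈ range (n + 1), n.choose i * Nat.bell i := by
  rw [Nat.bell_succ', ← Finset.Nat.sum_antidiagonal_swap,
    Finset.Nat.sum_antidiagonal_eq_sum_range_succ_mk]
  refine sum_congr rfl fun i hi => ?_
  rw [Prod.fst_swap, Prod.snd_swap, Nat.choose_symm (Nat.lt_succ_iff.1 (mem_range.1 hi))]

lemma bellFunctional_X_mul (q : R[X]) :
    bellFunctional R (X * q) = bellFunctional R (taylor 1 q) := by
  induction q using Polynomial.induction_on' with
  | add p q hp hq => rw [mul_add, map_add, hp, hq, map_add, map_add]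
  | monomial n a =>
    rw [X_mul_monomial, bellFunctional_monomial, bell_succ_eq_sum_range, taylor_monomial,
      bellFunctional_C_mul, add_pow, map_sum, mul_comm, Nat.cast_sum]
    congr 1
    refine sum_congr rfl fun i _ => ?_
    rw [C_1, one_pow, mul_one, mul_comm (X ^ i), ← C_eq_natCast, bellFunctional_C_mul,
      bellFunctional_X_pow, Nat.cast_mul]

lemma bellFunctional_descPochhammer_mul (b : ℕ) (q : R[X]) :
    bellFunctional R (descPochhammer R b * q) = bellFunctional R (taylor (b : R) q) := by
  induction b generalizing q with
  | zero => simp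
  | succ b ih =>
    have unshift : taylor (1 : R) ((descPochhammer R b).comp (X - 1)) = descPochhammer R b := by
      simp [taylor_apply, comp_assoc]
    rw [descPochhammer_succ_left, mul_assoc, bellFunctional_X_mul, taylor_mul, unshift, ih,
      taylor_taylor, Nat.cast_succ]

lemma bellFunctional_descPochhammer (b : ℕ) : bellFunctional R (descPochhammer R b) = 1 := by
  simpa [bellFunctional_one] using bellFunctional_descPochhammer_mul (R := R) b 1

end BellFunctional

section Uniqueness

/-- The largest ideal on which the umbral functional vanishes. -/
noncomputable def bellIdeal (R : Type*) [CommRing R] : Ideal R[X] where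
  carrier := {q | ∀ r, bellFunctional R (q * r) = 0}
  add_mem' hp hq r := by rw [add_mul, map_add, hp r, hq r, add_zero]
  zero_mem' r := by rw [zero_mul, map_zero]
  smul_mem' a q hq r := by rw [smul_eq_mul, mul_assoc, mul_left_comm, hq]

variable (p : ℕ) [hp : Fact p.Prime]

lemma descPochhammer_zmod_self : descPochhammer (ZMod p) p = X ^ p - X := by
  have natDegree_eq := FiniteField.X_pow_card_sub_X_natDegree_eq (ZMod p) hp.out.one_lt
  have monic : (X ^ p - X : (ZMod p)[X]).Monic :=
    monic_X_pow_sub (by rw [degree_X]; exact_mod_cast hp.out.one_lt)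
  have degree_eq : (descPochhammer (ZMod p) p).degree = p := by
    rw [degree_eq_natDegree (monic_descPochhammer _ _).ne_zero, descPochhammer_natDegree]
  refine eq_of_degree_le_of_eval_finset_eq univ ?_ ?_ ?_ fun a _ => ?_
  · rw [degree_eq, card_univ, ZMod.card]
  · rw [degree_eq, degree_eq_natDegree monic.ne_zero, natDegree_eq]
  · rw [(monic_descPochhammer _ _).leadingCoeff, monic.leadingCoeff]
  · rw [← ZMod.natCast_zmod_val a, descPochhammer_eval_eq_descFactorial,
      Nat.descFactorial_eq_zero_iff_lt.2 (ZMod.val_lt a), Nat.cast_zero, eval_sub, eval_pow,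
      eval_X, ZMod.pow_card, sub_self]

/- This is Touchard's congruence `B_{n + p} ≡ B_n + B_{n + 1}` modulo `p`. -/
lemma X_pow_sub_X_sub_one_mem_bellIdeal : X ^ p - X - 1 ∈ bellIdeal (ZMod p) := fun r => by
  have h := bellFunctional_descPochhammer_mul (R := ZMod p) p r
  rw [descPochhammer_zmod_self, CharP.cast_eq_zero, taylor_zero] at h
  rw [sub_mul, one_mul, map_sub, h, sub_self]

lemma comp_X_pow_sub_taylor_mem_bellIdeal (q : (ZMod p)[X]) :
    q.comp (X ^ p) - taylor 1 q ∈ bellIdeal (ZMod p) := by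
  refine Ideal.mem_of_dvd _ ?_ (X_pow_sub_X_sub_one_mem_bellIdeal p)
  rw [sub_sub, taylor_apply, C_1]
  simp only [comp, eval₂_eq_eval_map]
  exact sub_dvd_eval_sub _ _ _

variable {p}

lemma taylor_one_mem_bellIdeal {q : (ZMod p)[X]} (hq : q ∈ bellIdeal (ZMod p)) :
    taylor 1 q ∈ bellIdeal (ZMod p) := by
  have frobenius : q.comp (X ^ p) ∈ bellIdeal (ZMod p) := by
    rw [← expand_eq_comp_X_pow, ZMod.expand_card]
    exact Ideal.pow_mem_of_mem _ hq _ hp.out.pos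
  simpa using sub_mem frobenius (comp_X_pow_sub_taylor_mem_bellIdeal p q)

lemma eq_C_of_taylor_one_eq {q : (ZMod p)[X]} (hq : taylor 1 q = q) (hdeg : q.natDegree < p) :
    q = C (q.eval 0) := by
  have eval_natCast (n : ℕ) : q.eval (n : ZMod p) = q.eval 0 := by
    induction n with
    | zero => rw [Nat.cast_zero]
    | succ n ih => rw [Nat.cast_succ, ← taylor_eval, hq, ih]
  refine eq_of_natDegree_lt_card_of_eval_eq _ _ Function.injective_id (fun a => ?_) ?_
  · rw [id, eval_C, ← ZMod.natCast_zmod_val a, eval_natCast]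
  · rwa [natDegree_C, ZMod.card, max_lt_iff, and_iff_left hp.out.pos]

/- The ideal is stable under `X ↦ X + 1`, so it contains the difference `q(X + 1) - q(X)`, which
has smaller degree. -/
lemma eq_zero_of_mem_bellIdeal {q : (ZMod p)[X]} (hq : q ∈ bellIdeal (ZMod p))
    (hdeg : q.natDegree < p) : q = 0 := by
  induction h : q.natDegree using Nat.strong_induction_on generalizing q with
  | _ d ih =>
    have taylor_eq : taylor 1 q = q := by
      by_contra hne
      have hlt : (taylor 1 q - q).natDegree < d := by
        have hq0 : q ≠ 0 := by rintro rfl; exact hne (map_zero _)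
        have := degree_sub_lt_right (degree_taylor q 1) hq0 (leadingCoeff_taylor 1 q)
        exact h ▸ natDegree_lt_natDegree (sub_ne_zero.2 hne) this
      exact hne (sub_eq_zero.1
        (ih _ hlt (sub_mem (taylor_one_mem_bellIdeal hq) hq) (by omega) rfl))
    have hC := eq_C_of_taylor_one_eq taylor_eq hdeg
    have hL := hq 1
    rw [hC, bellFunctional_C_mul, bellFunctional_one, mul_one] at hL
    rw [hC, hL, C_0]

lemma mem_bellIdeal_of_forall_X_pow {g : (ZMod p)[X]}
    (hg : ∀ s, bellFunctional (ZMod p) (g * X ^ (p * s)) = 0) : g ∈ bellIdeal (ZMod p) := by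
  have comp_X_pow (q : (ZMod p)[X]) : bellFunctional (ZMod p) (g * q.comp (X ^ p)) = 0 := by
    induction q using Polynomial.induction_on' with
    | add a b ha hb => rw [add_comp, mul_add, map_add, ha, hb, add_zero]
    | monomial n a =>
      rw [← C_mul_X_pow_eq_monomial, C_mul_comp, X_pow_comp, mul_left_comm,
        bellFunctional_C_mul, ← pow_mul, hg, mul_zero]
  intro r
  have h := comp_X_pow_sub_taylor_mem_bellIdeal p (taylor (-1) r) g
  rwa [taylor_taylor, add_neg_cancel, taylor_zero, sub_mul, map_sub, mul_comm, comp_X_pow,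
    zero_sub, neg_eq_zero, mul_comm] at h

lemma eq_zero_of_sum_mul_bell_eq_zero_zmod {ι : Type*} {J : Finset ι} {e : ι → ℕ}
    (he : Set.InjOn e J) (hlt : ∀ j ∈ J, e j < p) {c : ι → ZMod p}
    (h : ∀ s, ∑ j ∈ J, c j * Nat.bell (p * s + e j) = 0) : ∀ j ∈ J, c j = 0 := by
  intro i hi
  have mem : ∑ j ∈ J, C (c j) * X ^ e j ∈ bellIdeal (ZMod p) := by
    refine mem_bellIdeal_of_forall_X_pow fun s => ?_
    rw [sum_mul, map_sum, ← h s]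
    refine sum_congr rfl fun j _ => ?_
    rw [mul_assoc, bellFunctional_C_mul, ← pow_add, bellFunctional_X_pow, add_comm]
  have deg : (∑ j ∈ J, C (c j) * X ^ e j).natDegree < p :=
    Nat.lt_of_le_pred hp.out.pos <| natDegree_sum_le_of_forall_le _ _ fun j hj =>
      (natDegree_C_mul_X_pow_le _ _).trans (Nat.le_pred_of_lt (hlt j hj))
  have coeff_eq := congrArg (coeff · (e i)) (eq_zero_of_mem_bellIdeal mem deg)
  simp only [finsetSum_coeff, coeff_C_mul_X_pow, coeff_zero] at coeff_eq
  rwa [sum_eq_single_of_mem i hi fun j hj hji => if_neg fun hij => hji (he hj hi hij.symm),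
    if_pos rfl] at coeff_eq

end Uniqueness

lemma eq_zero_of_sum_mul_bell_eq_zero_int {ι : Type*} {J : Finset ι} {e : ι → ℕ}
    (he : Set.InjOn e J) {S : ι → ℤ[X]}
    (h : ∀ t : ℕ, ∑ j ∈ J, (S j).eval (t : ℤ) * Nat.bell (t + e j) = 0) : ∀ j ∈ J, S j = 0 := by
  intro i hi
  have eval_eq_zero (t : ℕ) : (S i).eval (t : ℤ) = 0 := by
    obtain ⟨p, hp_ge, hp_prime⟩ :=
      Nat.exists_infinite_primes (t + J.sup e + ((S i).eval (t : ℤ)).natAbs + 1)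
    have : Fact p.Prime := ⟨hp_prime⟩
    have periodic (j : ι) (s : ℕ) : (((S j).eval ((p * s + t : ℕ) : ℤ) : ℤ) : ZMod p)
        = ((S j).eval (t : ℤ) : ℤ) := by
      symm
      refine (ZMod.intCast_eq_intCast_iff_dvd_sub _ _ _).2 (.trans ?_ (sub_dvd_eval_sub _ _ _))
      rw [Nat.cast_add, Nat.cast_mul, add_sub_cancel_right]
      exact dvd_mul_right _ _
    have cast_eq_zero := eq_zero_of_sum_mul_bell_eq_zero_zmod (p := p) (e := fun j => t + e j)
      (c := fun j => ((S j).eval (t : ℤ) : ℤ))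
      (fun a ha b hb hab => he ha hb (Nat.add_left_cancel hab))
      (fun j hj => by have := le_sup (f := e) hj; omega)
      (fun s => by
        have := congrArg (Int.cast : ℤ → ZMod p) (h (p * s + t))
        simpa only [Int.cast_sum, Int.cast_mul, periodic, Int.cast_natCast, add_assoc,
          Int.cast_zero] using this) i hi
    rw [ZMod.intCast_zmod_eq_zero_iff_dvd] at cast_eq_zero
    exact Int.eq_zero_of_abs_lt_dvd cast_eq_zero (by rw [Int.abs_eq_natAbs]; omega)
  refine eq_zero_of_infinite_isRoot _ ?_
  refine (Set.infinite_range_of_injective (Nat.cast_injective (R := ℤ))).mono ?_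
  rintro _ ⟨t, rfl⟩
  exact eval_eq_zero t

lemma exists_map_eq_C_mul {ι : Type*} (J : Finset ι) (S : ι → ℚ[X]) :
    ∃ N : ℤ, N ≠ 0 ∧ ∃ T : ι → ℤ[X], ∀ j ∈ J, (T j).map (Int.castRingHom ℚ) = C (N : ℚ) * S j := by
  let := Polynomial.algebra ℤ ℚ
  have := Polynomial.isLocalization (nonZeroDivisors ℤ) ℚ
  obtain ⟨⟨_, N, hN, rfl⟩, h⟩ := IsLocalization.exist_integer_multiples
    ((nonZeroDivisors ℤ).map (C : ℤ →+* ℤ[X])) J S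
  choose! T hT using h
  refine ⟨N, nonZeroDivisors.ne_zero hN, T, fun j hj => ?_⟩
  simpa [Algebra.smul_def] using hT j hj

lemma eq_zero_of_sum_mul_bell_eq_zero {ι : Type*} {J : Finset ι} {e : ι → ℕ}
    (he : Set.InjOn e J) {S : ι → ℚ[X]}
    (h : ∀ t : ℕ, ∑ j ∈ J, (S j).eval (t : ℚ) * Nat.bell (t + e j) = 0) : ∀ j ∈ J, S j = 0 := by
  obtain ⟨N, hN, T, hT⟩ := exists_map_eq_C_mul J S
  have eval_T (j) (hj : j ∈ J) (t : ℕ) :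
      (((T j).eval (t : ℤ) : ℤ) : ℚ) = N * (S j).eval (t : ℚ) := by
    simpa using congrArg (eval (t : ℚ)) (hT j hj)
  have T_eq_zero := eq_zero_of_sum_mul_bell_eq_zero_int he (S := T) fun t => by
    rw [← Int.cast_inj (α := ℚ), Int.cast_zero, ← mul_zero (N : ℚ), ← h t, mul_sum, Int.cast_sum]
    refine sum_congr rfl fun j hj => ?_
    rw [Int.cast_mul, eval_T j hj, Int.cast_natCast, mul_assoc]
  intro j hj
  have hTj := hT j hj
  rw [T_eq_zero j hj, Polynomial.map_zero] at hTj
  exact (mul_eq_zero.1 hTj.symm).resolve_left (C_ne_zero.2 (Int.cast_ne_zero.2 hN))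

section ShiftedBellPolynomial

/-- `evalAt` as a linear map from shifted Bell polynomials to sequences. -/
noncomputable def evalAtLinear : ShiftedBellPolynomial →ₗ[ℚ] ℕ → ℚ :=
  Finsupp.lsum ℚ fun j => LinearMap.pi fun n => bellNumber (n + j) • leval (n : ℚ)

lemma evalAtLinear_apply (R : ShiftedBellPolynomial) (n : ℕ) : evalAtLinear R n = evalAt R n := by
  simp [evalAtLinear, evalAt, Finsupp.sum, mul_comm]

lemma evalAt_single (j : ℤ) (q : ℚ[X]) (n : ℕ) :
    evalAt (Finsupp.single j q) n = q.eval (n : ℚ) * bellNumber (n + j) := by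
  rw [evalAt, Finsupp.sum_single_index (by rw [eval_zero, zero_mul])]

lemma eq_zero_of_evalAt_eventually_eq_zero {R : ShiftedBellPolynomial} {n₀ : ℕ}
    (h : ∀ n ≥ n₀, evalAt R n = 0) : R = 0 := by
  -- Past the shift `a`, all indices `n + j` are nonnegative.
  set a := n₀ + R.support.sup Int.natAbs
  have shift_nonneg {j : ℤ} (hj : j ∈ R.support) : 0 ≤ a + j := by
    have := le_sup (f := Int.natAbs) hj
    omega
  have taylor_eq_zero := eq_zero_of_sum_mul_bell_eq_zero (J := R.support)
    (e := fun j => (a + j).toNat) (S := fun j => taylor (a : ℚ) (R j))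
    (fun i hi j hj hij => by
      have := shift_nonneg hi
      have := shift_nonneg hj
      simp only at hij
      omega)
    (fun t => by
      rw [← h (t + a) (by omega), evalAt, Finsupp.sum]
      refine sum_congr rfl fun j hj => ?_
      have := shift_nonneg hj
      rw [taylor_eval, bellNumber, if_pos (by omega), ← Nat.cast_add,
        show t + (a + j).toNat = (((t + a : ℕ) : ℤ) + j).toNat by omega])
  ext1 j
  by_contra hj
  exact hj (by simpa using taylor_eq_zero j (Finsupp.mem_support_iff.2 hj))

lemma eq_of_evalAt_eventually_eq {R R' : ShiftedBellPolynomial} {n₀ : ℕ}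
    (h : ∀ n ≥ n₀, evalAt R n = evalAt R' n) : R = R' := by
  refine sub_eq_zero.1 (eq_zero_of_evalAt_eventually_eq_zero (n₀ := n₀) fun n hn => ?_)
  rw [← evalAtLinear_apply, map_sub, Pi.sub_apply, evalAtLinear_apply, evalAtLinear_apply, h n hn,
    sub_self]

/-- The shifted Bell polynomials `∑ Q_j(n) B_{n+j}` with `Q_j = 0` for `j < -k` and of degree at
most `D`, where `Q_j(n) B_{n+j}` counts with degree `deg Q_j + j` if `0 ≤ j`, and with degree
`deg Q_j + j + 1` if `j < 0`. -/
def boundedBell (k D : ℕ) : Submodule ℚ ShiftedBellPolynomial where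
  carrier := {R | ∀ j ∈ R.support,
    -k ≤ j ∧ (R j).natDegree + j ≤ D ∧ (j < 0 → (R j).natDegree + j < D)}
  zero_mem' := by simp
  add_mem' {R R'} hR hR' j hj := by
    by_cases h : R j = 0
    · have h' : R' j ≠ 0 := fun h' => Finsupp.mem_support_iff.1 hj (by simp [h, h'])
      simpa [h] using hR' j (Finsupp.mem_support_iff.2 h')
    by_cases h' : R' j = 0
    · simpa [h'] using hR j (Finsupp.mem_support_iff.2 h)
    have := hR j (Finsupp.mem_support_iff.2 h)
    have := hR' j (Finsupp.mem_support_iff.2 h')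
    have := natDegree_add_le (R j) (R' j)
    rw [Finsupp.add_apply]
    omega
  smul_mem' a R hR j hj := by
    have := hR j (Finsupp.support_smul hj)
    have := natDegree_smul_le a (R j)
    rw [Finsupp.smul_apply]
    omega

lemma natDegree_le_of_mem_boundedBell {k D : ℕ} {R : ShiftedBellPolynomial}
    (hR : R ∈ boundedBell k D) (j : ℕ) : (R (D - j)).natDegree ≤ j := by
  by_cases hj : (D - j : ℤ) ∈ R.support
  · have := hR _ hj
    omega
  · simp [Finsupp.notMem_support_iff.1 hj]

lemma natDegree_lt_of_mem_boundedBell {k D : ℕ} {R : ShiftedBellPolynomial}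
    (hR : R ∈ boundedBell k D) {j : ℕ} (hj : D < j) : (R (D - j)).natDegree < j := by
  by_cases hj' : (D - j : ℤ) ∈ R.support
  · have := hR _ hj'
    omega
  · rw [Finsupp.notMem_support_iff.1 hj', natDegree_zero]
    exact hj.pos

/-- The sequences `a` for which there is a shifted Bell polynomial `R ∈ boundedBell k D` with
`a n = R(n)` for all `n ≥ k - 1`. -/
def bellSequences (k D : ℕ) : Submodule ℚ (ℕ → ℚ) where
  carrier := {a | ∃ R ∈ boundedBell k D, ∀ n, k ≤ n + 1 → a n = evalAt R n}
  zero_mem' := ⟨0, zero_mem _, fun n _ => by rw [← evalAtLinear_apply, map_zero]⟩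
  add_mem' := by
    rintro _ _ ⟨R, hR, h⟩ ⟨R', hR', h'⟩
    refine ⟨R + R', add_mem hR hR', fun n hn => ?_⟩
    rw [Pi.add_apply, h n hn, h' n hn, ← evalAtLinear_apply (R + R'), map_add, Pi.add_apply,
      evalAtLinear_apply, evalAtLinear_apply]
  smul_mem' := by
    rintro c _ ⟨R, hR, h⟩
    refine ⟨c • R, Submodule.smul_mem _ c hR, fun n hn => ?_⟩
    rw [Pi.smul_apply, h n hn, ← evalAtLinear_apply (c • R), map_smul, Pi.smul_apply,
      evalAtLinear_apply]

lemma bellSequences_mono {k k' D D' : ℕ} (hk : k ≤ k') (hD : D ≤ D') :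
    bellSequences k D ≤ bellSequences k' D' := by
  rintro a ⟨R, hR, h⟩
  refine ⟨R, fun j hj => ?_, fun n hn => h n (hk.trans hn)⟩
  have := hR j hj
  omega

lemma mem_bellSequences_congr {k D : ℕ} {a a' : ℕ → ℚ} (ha' : a' ∈ bellSequences k D)
    (h : ∀ n, k ≤ n + 1 → a n = a' n) : a ∈ bellSequences k D := by
  obtain ⟨R, hR, ha'⟩ := ha'
  exact ⟨R, hR, fun n hn => (h n hn).trans (ha' n hn)⟩

lemma natCast_pow_mul_mem_bellSequences {k D : ℕ} {a : ℕ → ℚ} (ha : a ∈ bellSequences k D)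
    (e : ℕ) : (fun n : ℕ => (n : ℚ) ^ e * a n) ∈ bellSequences k (D + e) := by
  obtain ⟨R, hR, h⟩ := ha
  refine ⟨R.mapRange (X ^ e * ·) (mul_zero _), fun j hj => ?_, fun n hn => ?_⟩
  · have := hR j (Finsupp.support_mapRange hj)
    have := natDegree_mul_le (p := X ^ e) (q := R j)
    rw [natDegree_X_pow] at this
    rw [Finsupp.mapRange_apply]
    omega
  · simp only [h n hn]
    rw [evalAt, evalAt, Finsupp.sum_mapRange_index fun j => by simp, Finsupp.mul_sum]
    simp only [eval_mul, eval_pow, eval_X, mul_assoc]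

lemma mem_bellSequences_of_eq_mul_bellNumber {k D : ℕ} {j : ℤ} {q : ℚ[X]} {a : ℕ → ℚ}
    (hj : -k ≤ j) (hq : q.natDegree + j ≤ D) (hq' : j < 0 → q.natDegree + j < D)
    (ha : ∀ n : ℕ, a n = q.eval (n : ℚ) * bellNumber (n + j)) : a ∈ bellSequences k D := by
  refine ⟨Finsupp.single j q, fun i hi => ?_, fun n _ => by rw [ha n, evalAt_single]⟩
  obtain rfl := Finset.mem_singleton.1 (Finsupp.support_single_subset hi)
  rw [Finsupp.single_eq_same]
  exact ⟨hj, hq, hq'⟩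

end ShiftedBellPolynomial

section RationalSeries

section GeomSeries

variable {A : Type*} [CommRing A]

/-- The power series `1 / (1 - u T) = ∑ u ^ n T ^ n`. -/
noncomputable def geomSeries (u : A) : A⟦X⟧ := PowerSeries.rescale u (PowerSeries.mk 1)

lemma geomSeries_mul_one_sub (u : A) :
    geomSeries u * (1 - PowerSeries.C u * PowerSeries.X) = 1 := by
  rw [geomSeries, ← PowerSeries.rescale_X, ← map_one (PowerSeries.rescale u), ← map_sub,
    ← map_mul, PowerSeries.mk_one_mul_one_sub_eq_one]

lemma geomSeries_zero : geomSeries (0 : A) = 1 := by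
  simpa using geomSeries_mul_one_sub (0 : A)

lemma coeff_geomSeries_pow (u : A) (s n : ℕ) :
    PowerSeries.coeff n (geomSeries u ^ (s + 1)) = u ^ n * (s + n).choose s := by
  rw [geomSeries, ← map_pow, PowerSeries.mk_one_pow_eq_mk_choose_add, PowerSeries.coeff_rescale,
    PowerSeries.coeff_mk]

lemma coeff_geomSeries (u : A) (n : ℕ) : PowerSeries.coeff n (geomSeries u) = u ^ n := by
  simpa using coeff_geomSeries_pow u 0 n

lemma derivative_geomSeries (u : A) :
    d⁄dX A (geomSeries u) = PowerSeries.C u * geomSeries u ^ 2 := by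
  have leibniz := congrArg (d⁄dX A) (geomSeries_mul_one_sub u)
  simp only [Derivation.leibniz, map_sub, Derivation.map_one_eq_zero, PowerSeries.derivative_C,
    PowerSeries.derivative_X, smul_eq_mul, mul_one, mul_zero, add_zero, zero_sub] at leibniz
  linear_combination (exp := 1) geomSeries u * leibniz
    - d⁄dX A (geomSeries u) * geomSeries_mul_one_sub u

lemma X_mul_derivative_X_pow_mul_geomSeries_pow (u : A) (m s : ℕ) :
    PowerSeries.X * d⁄dX A (PowerSeries.X ^ m * geomSeries u ^ (s + 1))
      = (m : A⟦X⟧) * (PowerSeries.X ^ m * geomSeries u ^ (s + 1))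
        + (s + 1 : A⟦X⟧)
          * (PowerSeries.C u * (PowerSeries.X ^ (m + 1) * geomSeries u ^ (s + 2))) := by
  rw [Derivation.leibniz, Derivation.leibniz_pow, Derivation.leibniz_pow, derivative_geomSeries,
    PowerSeries.derivative_X]
  rcases m with _ | m <;> simp <;> ring

lemma X_mul_geomSeries_mul_geomSeries {u v w : A} (hw : w * (u - v) = 1) :
    PowerSeries.X * (geomSeries u * geomSeries v)
      = PowerSeries.C w * (geomSeries u - geomSeries v) := by
  have hw' := congrArg PowerSeries.C hw
  simp only [map_mul, map_sub, map_one] at hw'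
  linear_combination PowerSeries.C w * geomSeries u * geomSeries_mul_one_sub v
    - PowerSeries.C w * geomSeries v * geomSeries_mul_one_sub u
    - PowerSeries.X * geomSeries u * geomSeries v * hw'

/-- The power series `T ^ (c + s) * q / (1 - u T) ^ (s + 1)`. -/
noncomputable def rationalTerm (u : A) (c s : ℕ) (q : A) : A⟦X⟧ :=
  PowerSeries.X ^ (c + s) * geomSeries u ^ (s + 1) * PowerSeries.C q

lemma geomSeries_eq_rationalTerm (u : A) : geomSeries u = rationalTerm u 0 0 1 := by
  simp [rationalTerm]

lemma coeff_rationalTerm (u : A) {c s n : ℕ} (hn : c + s ≤ n) (q : A) :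
    PowerSeries.coeff n (rationalTerm u c s q) = (n - c).choose s * (u ^ (n - (c + s)) * q) := by
  obtain ⟨m, rfl⟩ := Nat.exists_eq_add_of_le' hn
  rw [rationalTerm, PowerSeries.coeff_mul_C, PowerSeries.coeff_X_pow_mul, coeff_geomSeries_pow,
    show m + (c + s) - c = s + m by omega, Nat.add_sub_cancel]
  ring

lemma coeff_rationalTerm_of_lt (u : A) {c s n : ℕ} (hn : n < c + s) (q : A) :
    PowerSeries.coeff n (rationalTerm u c s q) = 0 := by
  rw [rationalTerm, mul_assoc, PowerSeries.coeff_X_pow_mul', if_neg (by omega)]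

lemma X_mul_rationalTerm (u : A) (c s : ℕ) (q : A) :
    PowerSeries.X * rationalTerm u c s q = rationalTerm u (c + 1) s q := by
  rw [rationalTerm, rationalTerm]
  ring

lemma X_mul_geomSeries_mul_rationalTerm_self (u : A) (c s : ℕ) (q : A) :
    PowerSeries.X * geomSeries u * rationalTerm u c s q = rationalTerm u c (s + 1) q := by
  rw [rationalTerm, rationalTerm]
  ring

lemma X_mul_geomSeries_mul_rationalTerm_zero {u v w : A} (hw : w * (u - v) = 1) (c : ℕ) (q : A) :
    PowerSeries.X * geomSeries v * rationalTerm u c 0 q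
      = rationalTerm u c 0 (w * q) - rationalTerm v c 0 (w * q) := by
  simp only [rationalTerm, map_mul]
  linear_combination PowerSeries.X ^ c * PowerSeries.C q * X_mul_geomSeries_mul_geomSeries hw

lemma X_mul_geomSeries_mul_rationalTerm_succ {u v w : A} (hw : w * (u - v) = 1) (c s : ℕ)
    (q : A) :
    PowerSeries.X * geomSeries v * rationalTerm u c (s + 1) q
      = rationalTerm u c (s + 1) (w * q)
        - PowerSeries.X * geomSeries v * rationalTerm u c s (w * q) := by
  simp only [rationalTerm, map_mul]
  linear_combination PowerSeries.X ^ (c + s + 1) * geomSeries u ^ (s + 1) * PowerSeries.C q *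
    X_mul_geomSeries_mul_geomSeries hw

/-- The operator on power series that multiplies the `n`-th coefficient by `n + 1`. -/
noncomputable def succWeight : A⟦X⟧ →ₗ[A] A⟦X⟧ :=
  LinearMap.mulLeft A PowerSeries.X ∘ₗ (d⁄dX A).toLinearMap + LinearMap.id

lemma succWeight_apply (F : A⟦X⟧) : succWeight F = PowerSeries.X * d⁄dX A F + F := rfl

lemma coeff_succWeight (F : A⟦X⟧) (n : ℕ) :
    PowerSeries.coeff n (succWeight F) = (n + 1) * PowerSeries.coeff n F := by
  rw [succWeight_apply, map_add]
  cases n with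
  | zero => simp
  | succ n =>
    rw [PowerSeries.coeff_succ_X_mul, PowerSeries.coeff_derivative, Nat.cast_succ]
    ring

lemma succWeight_rationalTerm (u : A) (c s : ℕ) (q : A) :
    succWeight (rationalTerm u c s q)
      = rationalTerm u c s ((c + s + 1) * q) + rationalTerm u c (s + 1) (u * ((s + 1) * q)) := by
  rw [succWeight_apply, rationalTerm, Derivation.leibniz, PowerSeries.derivative_C, smul_zero,
    zero_add, smul_eq_mul, mul_left_comm, X_mul_derivative_X_pow_mul_geomSeries_pow]
  simp only [rationalTerm, map_mul, map_add, map_natCast, map_one]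
  push_cast
  ring

end GeomSeries

/-- The sums of series `T ^ (c + s) * u ^ r * p / (1 - u T) ^ (s + 1)`, where `u = X - b`, with
`b ≤ l`, `c ≤ c₀`, `c + s ≤ k + r` and `r + deg p ≤ d`. The generating functions of increasing
`k`-tuples, with factors `0` or `u` for the points of the gaps and with a monomial weight of degree
`d`, are of this form. -/
noncomputable def rationalSeries (l c₀ k d : ℕ) : AddSubgroup ℚ[X]⟦X⟧ :=
  AddSubgroup.closure {F | ∃ b c s r : ℕ, ∃ p : ℚ[X],
    b ≤ l ∧ c ≤ c₀ ∧ c + s ≤ k + r ∧ r + p.natDegree ≤ d ∧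
      F = rationalTerm (X - (b : ℚ[X])) c s ((X - (b : ℚ[X])) ^ r * p)}

variable {l c₀ k d b c s r : ℕ} {p : ℚ[X]} {F : ℚ[X]⟦X⟧}

lemma rationalTerm_mem (hb : b ≤ l) (hc : c ≤ c₀) (hcs : c + s ≤ k + r)
    (hr : r + p.natDegree ≤ d) :
    rationalTerm (X - (b : ℚ[X])) c s ((X - (b : ℚ[X])) ^ r * p) ∈ rationalSeries l c₀ k d :=
  AddSubgroup.subset_closure ⟨b, c, s, r, p, hb, hc, hcs, hr, rfl⟩

lemma rationalSeries_le {V : AddSubgroup ℚ[X]⟦X⟧}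
    (h : ∀ b c s r p, b ≤ l → c ≤ c₀ → c + s ≤ k + r → r + p.natDegree ≤ d →
      rationalTerm (X - (b : ℚ[X])) c s ((X - (b : ℚ[X])) ^ r * p) ∈ V) :
    rationalSeries l c₀ k d ≤ V := by
  refine (AddSubgroup.closure_le V).2 ?_
  rintro _ ⟨b, c, s, r, p, hb, hc, hcs, hr, rfl⟩
  exact h b c s r p hb hc hcs hr

lemma rationalSeries_mono {c₀' k' d' : ℕ} (hc₀ : c₀ ≤ c₀') (hk : k ≤ k') (hd : d ≤ d') :
    rationalSeries l c₀ k d ≤ rationalSeries l c₀' k' d' :=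
  rationalSeries_le fun _ _ _ _ _ hb hc hcs hr =>
    rationalTerm_mem hb (hc.trans hc₀) (hcs.trans (by omega)) (hr.trans hd)

lemma geomSeries_mem_rationalSeries (hb : b ≤ l) :
    geomSeries (X - (b : ℚ[X])) ∈ rationalSeries l 0 0 0 := by
  have mem := rationalTerm_mem (k := 0) (d := 0) (s := 0) (r := 0) (p := 1) hb le_rfl le_rfl
    (by rw [natDegree_one])
  rwa [pow_zero, one_mul, ← geomSeries_eq_rationalTerm] at mem

lemma X_mul_mem_rationalSeries (hF : F ∈ rationalSeries l c₀ k d) :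
    PowerSeries.X * F ∈ rationalSeries l (c₀ + 1) (k + 1) d := by
  refine rationalSeries_le (V := (rationalSeries l (c₀ + 1) (k + 1) d).comap
    (AddMonoidHom.mulLeft PowerSeries.X)) (fun b c s r p hb hc hcs hr => ?_) hF
  rw [AddSubgroup.mem_comap, AddMonoidHom.coe_mulLeft, X_mul_rationalTerm]
  exact rationalTerm_mem hb (by omega) (by omega) hr

lemma natDegree_X_sub_natCast_pow_mul_le (b r : ℕ) (p : ℚ[X]) :
    ((X - (b : ℚ[X])) ^ r * p).natDegree ≤ r + p.natDegree := by
  refine natDegree_mul_le.trans (Nat.add_le_add_right (natDegree_pow_le.trans ?_) _)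
  rw [← C_eq_natCast, natDegree_X_sub_C, mul_one]

lemma X_mul_geomSeries_mul_rationalTerm_mem {a : ℕ} (ha : a ≤ l) (hb : b ≤ l) (hc : c ≤ c₀)
    (hk : c₀ ≤ k + 1) (hcs : c + s ≤ k + r) (hr : r + p.natDegree ≤ d) :
    PowerSeries.X * geomSeries (X - (a : ℚ[X])) *
        rationalTerm (X - (b : ℚ[X])) c s ((X - (b : ℚ[X])) ^ r * p)
      ∈ rationalSeries l c₀ (k + 1) d := by
  rcases eq_or_ne a b with rfl | hab
  · rw [X_mul_geomSeries_mul_rationalTerm_self]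
    exact rationalTerm_mem ha hc (by omega) hr
  have hw : C ((a : ℚ) - b)⁻¹ * ((X - (b : ℚ[X])) - (X - (a : ℚ[X]))) = 1 := by
    rw [sub_sub_sub_cancel_left, ← C_eq_natCast, ← C_eq_natCast, ← C_sub, ← C_mul,
      inv_mul_cancel₀ (sub_ne_zero.2 (by exact_mod_cast hab)), C_1]
  induction s generalizing p with
  | zero =>
    rw [X_mul_geomSeries_mul_rationalTerm_zero hw, mul_left_comm]
    have := natDegree_C_mul_le ((a : ℚ) - b)⁻¹ p
    refine sub_mem (rationalTerm_mem hb hc (by omega) (by omega)) ?_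
    have := natDegree_X_sub_natCast_pow_mul_le b r (C ((a : ℚ) - b)⁻¹ * p)
    have mem := rationalTerm_mem (k := k + 1) (d := d) (s := 0) (r := 0)
      (p := (X - (b : ℚ[X])) ^ r * (C ((a : ℚ) - b)⁻¹ * p)) ha hc (by omega) (by omega)
    rwa [pow_zero, one_mul] at mem
  | succ s ih =>
    rw [X_mul_geomSeries_mul_rationalTerm_succ hw, mul_left_comm]
    have := natDegree_C_mul_le ((a : ℚ) - b)⁻¹ p
    exact sub_mem (rationalTerm_mem hb hc (by omega) (by omega)) (ih (by omega) (by omega))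

lemma X_mul_geomSeries_mul_mem_rationalSeries {a : ℕ} (ha : a ≤ l) (hk : c₀ ≤ k + 1)
    (hF : F ∈ rationalSeries l c₀ k d) :
    PowerSeries.X * geomSeries (X - (a : ℚ[X])) * F ∈ rationalSeries l c₀ (k + 1) d := by
  refine rationalSeries_le (V := (rationalSeries l c₀ (k + 1) d).comap
    (AddMonoidHom.mulLeft (PowerSeries.X * geomSeries (X - (a : ℚ[X])))))
    (fun b c s r p hb hc hcs hr => ?_) hF
  rw [AddSubgroup.mem_comap, AddMonoidHom.coe_mulLeft]
  exact X_mul_geomSeries_mul_rationalTerm_mem ha hb hc hk hcs hr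

lemma succWeight_mem_rationalSeries (hF : F ∈ rationalSeries l c₀ k d) :
    succWeight F ∈ rationalSeries l c₀ k (d + 1) := by
  refine rationalSeries_le (V := (rationalSeries l c₀ k (d + 1)).comap
    (succWeight (A := ℚ[X])).toAddMonoidHom) (fun b c s r p hb hc hcs hr => ?_) hF
  rw [AddSubgroup.mem_comap, LinearMap.toAddMonoidHom_coe, succWeight_rationalTerm]
  have degree_le (e : ℕ) : ((e : ℚ[X]) * p).natDegree ≤ p.natDegree := by
    rw [← C_eq_natCast e]
    exact natDegree_C_mul_le _ p
  have := degree_le (c + s + 1)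
  have := degree_le (s + 1)
  rw [mul_left_comm _ (_ ^ r), mul_left_comm _ (_ ^ r), ← mul_assoc _ (_ ^ r), ← pow_succ']
  norm_cast at *
  exact add_mem (rationalTerm_mem hb hc hcs (by omega))
    (rationalTerm_mem hb hc (by omega) (by omega))

lemma succWeight_pow_mem_rationalSeries (hF : F ∈ rationalSeries l c₀ k d) (e : ℕ) :
    (succWeight ^ e) F ∈ rationalSeries l c₀ k (d + e) := by
  induction e with
  | zero => exact hF
  | succ e ih =>
    rw [pow_succ', Module.End.mul_apply]
    exact succWeight_mem_rationalSeries ih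

end RationalSeries

section BellFunctionalSeries

/-- The polynomial whose value at `n ≥ c` is `C(n - c, s)`. -/
noncomputable def choosePoly (c s : ℕ) : ℚ[X] :=
  C (s.factorial : ℚ)⁻¹ * (descPochhammer ℚ s).comp (X - (c : ℚ[X]))

lemma eval_choosePoly {c n : ℕ} (h : c ≤ n) (s : ℕ) :
    (choosePoly c s).eval (n : ℚ) = (n - c).choose s := by
  rw [choosePoly, eval_mul, eval_C, eval_comp, eval_sub, eval_X, eval_natCast, ← Nat.cast_sub h,
    descPochhammer_eval_eq_descFactorial, Nat.descFactorial_eq_factorial_mul_choose, Nat.cast_mul,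
    inv_mul_cancel_left₀ (by exact_mod_cast s.factorial_ne_zero)]

lemma natDegree_choosePoly_le (c s : ℕ) : (choosePoly c s).natDegree ≤ s := by
  refine (natDegree_C_mul_le _ _).trans ?_
  rw [natDegree_comp, descPochhammer_natDegree, ← C_eq_natCast, natDegree_X_sub_C, mul_one]

lemma bellFunctional_mul_X_pow (q : ℚ[X]) (e : ℕ) {N : ℕ} (hN : q.natDegree ≤ N) :
    bellFunctional ℚ (q * X ^ e) = ∑ i ∈ range (N + 1), q.coeff i * Nat.bell (e + i) := by
  conv_lhs => rw [as_sum_range_C_mul_X_pow' (n := N + 1) q (by omega)]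
  rw [sum_mul, map_sum]
  refine sum_congr rfl fun i _ => ?_
  rw [mul_assoc, bellFunctional_C_mul, ← pow_add, bellFunctional_X_pow, add_comm i]

lemma bellFunctional_descPochhammer_mul_X_sub_pow_mul {l b : ℕ} (hb : b ≤ l) (e : ℕ) (p : ℚ[X]) :
    bellFunctional ℚ (descPochhammer ℚ l * ((X - (b : ℚ[X])) ^ e * p))
      = bellFunctional ℚ (descPochhammer ℚ (l - b) * taylor (b : ℚ) p * X ^ e) := by
  have split : descPochhammer ℚ l
      = descPochhammer ℚ b * (descPochhammer ℚ (l - b)).comp (X - (b : ℚ[X])) := by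
    rw [descPochhammer_mul, Nat.add_sub_cancel' hb]
  have unshift : taylor (b : ℚ) ((descPochhammer ℚ (l - b)).comp (X - (b : ℚ[X])))
      = descPochhammer ℚ (l - b) := by
    simp [taylor_apply, comp_assoc]
  have unshift_X : taylor (b : ℚ) (X - (b : ℚ[X])) = X := by
    simp [taylor_apply]
  rw [split, mul_assoc, bellFunctional_descPochhammer_mul, taylor_mul, unshift, taylor_mul,
    taylor_pow, unshift_X, mul_assoc, mul_comm (X ^ e)]

lemma bellFunctional_coeff_rationalTerm {l b c s r N : ℕ} {p : ℚ[X]} (hb : b ≤ l)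
    (hN : l - b + p.natDegree ≤ N) {n : ℕ} (hn : c ≤ n) :
    bellFunctional ℚ (descPochhammer ℚ l * PowerSeries.coeff n
        (rationalTerm (X - (b : ℚ[X])) c s ((X - (b : ℚ[X])) ^ r * p)))
      = ∑ i ∈ range (N + 1),
          (C ((descPochhammer ℚ (l - b) * taylor (b : ℚ) p).coeff i) * choosePoly c s).eval (n : ℚ)
            * bellNumber (n + (i + r - c - s : ℤ)) := by
  simp only [eval_mul, eval_C, eval_choosePoly hn]
  rcases lt_or_ge n (c + s) with hlt | hle
  · rw [coeff_rationalTerm_of_lt _ hlt, Nat.choose_eq_zero_of_lt (by omega)]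
    simp
  have degree_le : (descPochhammer ℚ (l - b) * taylor (b : ℚ) p).natDegree ≤ N := by
    refine natDegree_mul_le.trans ?_
    rwa [descPochhammer_natDegree, natDegree_taylor]
  rw [coeff_rationalTerm _ hle, ← C_eq_natCast, mul_left_comm, bellFunctional_C_mul,
    ← mul_assoc (_ ^ _), ← pow_add, bellFunctional_descPochhammer_mul_X_sub_pow_mul hb,
    bellFunctional_mul_X_pow _ _ degree_le, mul_sum]
  refine sum_congr rfl fun i _ => ?_
  rw [bellNumber, if_pos (by omega),
    show ((n : ℤ) + (i + r - c - s)).toNat = n - (c + s) + r + i by omega]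
  ring

lemma bellFunctional_coeff_mem_bellSequences {l c₀ k d : ℕ} {F : ℚ[X]⟦X⟧} (hl : l ≤ k)
    (hc₀ : c₀ ≤ k - 1) (hF : F ∈ rationalSeries l c₀ k d) :
    (fun n => bellFunctional ℚ (descPochhammer ℚ l * PowerSeries.coeff n F))
      ∈ bellSequences k (k + d) := by
  induction hF using AddSubgroup.closure_induction with
  | zero =>
    simp only [map_zero, mul_zero]
    exact zero_mem (bellSequences k (k + d))
  | add F G _ _ hF hG =>
    simp only [map_add, mul_add]
    exact add_mem hF hG
  | neg F _ hF =>
    simp only [map_neg, mul_neg]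
    exact neg_mem hF
  | mem F hF =>
    obtain ⟨b, c, s, r, p, hb, hc, hcs, hr, rfl⟩ := hF
    have term_mem : ∀ i ∈ range (l - b + p.natDegree + 1), (fun n : ℕ =>
        (C ((descPochhammer ℚ (l - b) * taylor (b : ℚ) p).coeff i) * choosePoly c s).eval (n : ℚ)
          * bellNumber (n + (i + r - c - s : ℤ))) ∈ bellSequences k (k + d) := fun i hi => by
      have := mem_range.1 hi
      have := (natDegree_C_mul_le ((descPochhammer ℚ (l - b) * taylor (b : ℚ) p).coeff i)
        (choosePoly c s)).trans (natDegree_choosePoly_le c s)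
      exact mem_bellSequences_of_eq_mul_bellNumber (by omega) (by omega) (by omega) fun n => rfl
    exact mem_bellSequences_congr (sum_mem term_mem) fun n hn => by
      rw [bellFunctional_coeff_rationalTerm hb le_rfl (by omega), Finset.sum_apply]

end BellFunctionalSeries

section TupleSeries

/-- The number of entries of `x` below `y`. -/
def position {α : Type*} [LinearOrder α] {k : ℕ} (x : Fin k → α) (y : α) : ℕ := #{i | x i < y}

/-- The strictly increasing `k`-tuples with entries below `n`. -/
noncomputable def increasingTuples (k n : ℕ) : Finset (Fin k → ℕ) := by
  classical exact {x ∈ Fintype.piFinset fun _ : Fin k => range n | StrictMono x}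

lemma mem_increasingTuples {k n : ℕ} {x : Fin k → ℕ} :
    x ∈ increasingTuples k n ↔ (∀ i, x i < n) ∧ StrictMono x := by
  simp [increasingTuples]

lemma increasingTuples_zero (n : ℕ) : increasingTuples 0 n = {Fin.elim0} := by
  ext x
  rw [mem_increasingTuples, mem_singleton]
  exact ⟨fun _ => Subsingleton.elim _ _, fun _ => ⟨fun i => i.elim0, fun i => i.elim0⟩⟩

lemma snoc_mem_increasingTuples {k n y : ℕ} {x : Fin k → ℕ} (hx : x ∈ increasingTuples k y)
    (hy : y < n) : (Fin.snoc x y : Fin (k + 1) → ℕ) ∈ increasingTuples (k + 1) n := by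
  rw [mem_increasingTuples] at hx ⊢
  refine ⟨Fin.lastCases (by simpa using hy) fun i => by simpa using (hx.1 i).trans hy,
    fun i j hij => ?_⟩
  obtain ⟨i, rfl⟩ := Fin.exists_castSucc_eq.2 (hij.trans_le (Fin.le_last j)).ne
  cases j using Fin.lastCases with
  | last => simpa using hx.1 i
  | cast j => simpa using hx.2 (Fin.castSucc_lt_castSucc_iff.1 hij)

lemma sum_increasingTuples_succ {M : Type*} [AddCommMonoid M] (k n : ℕ)
    (F : (Fin (k + 1) → ℕ) → M) :
    ∑ x ∈ increasingTuples (k + 1) n, F x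
      = ∑ y ∈ range n, ∑ x ∈ increasingTuples k y, F (Fin.snoc x y : Fin (k + 1) → ℕ) := by
  rw [sum_sigma']
  refine sum_nbij' (fun x => (⟨x (Fin.last k), Fin.init x⟩ : Σ _ : ℕ, Fin k → ℕ))
    (fun p => (Fin.snoc p.2 p.1 : Fin (k + 1) → ℕ)) (fun x hx => ?_) (fun p hp => ?_)
    (fun x _ => Fin.snoc_init_self x) (fun p _ => by simp) (fun x _ => by simp)
  · rw [mem_increasingTuples] at hx
    rw [mem_sigma, mem_range, mem_increasingTuples]
    exact ⟨hx.1 _, fun i => hx.2 (Fin.castSucc_lt_last i),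
      fun i j hij => hx.2 (Fin.castSucc_lt_castSucc_iff.2 hij)⟩
  · rw [mem_sigma, mem_range] at hp
    exact snoc_mem_increasingTuples hp.2 hp.1

lemma mem_range_snoc {k : ℕ} {x : Fin k → ℕ} {y z : ℕ} :
    z ∈ Set.range (Fin.snoc x y : Fin (k + 1) → ℕ) ↔ z = y ∨ z ∈ Set.range x := by
  simp only [Set.mem_range, Fin.exists_fin_succ', Fin.snoc_castSucc, Fin.snoc_last, or_comm,
    eq_comm]

lemma position_snoc {k : ℕ} (x : Fin k → ℕ) (y z : ℕ) :
    position (Fin.snoc x y : Fin (k + 1) → ℕ) z = position x z + if y < z then 1 else 0 := by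
  simp only [position, card_filter, Fin.sum_univ_castSucc, Fin.snoc_castSucc, Fin.snoc_last]

variable {A : Type*} [CommRing A]

open Classical in
/-- The product of the factors `u (position x y)` over the points `y < n` that `x` avoids. -/
noncomputable def gapWeight (u : ℕ → A) {k : ℕ} (x : Fin k → ℕ) (n : ℕ) : A :=
  ∏ y ∈ range n, if y ∈ Set.range x then 1 else u (position x y)

lemma gapWeight_snoc (u : ℕ → A) {k n y : ℕ} {x : Fin k → ℕ} (hx : x ∈ increasingTuples k y)
    (hy : y ≤ n) :
    gapWeight u (Fin.snoc x y : Fin (k + 1) → ℕ) (n + 1)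
      = gapWeight u x y * u (k + 1) ^ (n - y) := by
  rw [mem_increasingTuples] at hx
  obtain ⟨m, rfl⟩ := Nat.exists_eq_add_of_le hy
  simp only [gapWeight, show y + m + 1 = y + (1 + m) by omega, prod_range_add, prod_range_one,
    mem_range_snoc, add_zero, true_or, if_true, one_mul, Nat.add_sub_cancel_left]
  congr 1
  · refine prod_congr rfl fun z hz => ?_
    have hz := mem_range.1 hz
    simp only [hz.ne, false_or, position_snoc, hz.not_gt, if_false, add_zero]
  · have factor_eq (z : ℕ) : (if y + (1 + z) = y ∨ y + (1 + z) ∈ Set.range x then 1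
        else u (position (Fin.snoc x y : Fin (k + 1) → ℕ) (y + (1 + z)))) = u (k + 1) := by
      have lt (i : Fin k) : x i < y + (1 + z) := (hx.1 i).trans (by omega)
      rw [if_neg (by rintro (h | ⟨i, hi⟩); exacts [by omega, (lt i).ne hi]), position_snoc,
        if_pos (by omega), position, filter_true_of_mem fun i _ => lt i, card_univ,
        Fintype.card_fin]
    simp only [factor_eq, prod_const, card_range]

/-- The sum over the increasing `k`-tuples `x` below `n` of the product of the monomial
`∏ (x j + 1) ^ d j` and the gap weight of `x`. -/
noncomputable def tupleSum {k : ℕ} (d : Fin k → ℕ) (u : ℕ → A) (n : ℕ) : A :=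
  ∑ x ∈ increasingTuples k n, (∏ j, (x j + 1 : A) ^ d j) * gapWeight u x n

lemma tupleSum_succ {k : ℕ} (d : Fin (k + 1) → ℕ) (u : ℕ → A) (n : ℕ) :
    tupleSum d u (n + 1) = ∑ y ∈ range (n + 1),
      (y + 1 : A) ^ d (Fin.last k) * tupleSum (fun j => d j.castSucc) u y
        * u (k + 1) ^ (n - y) := by
  rw [tupleSum, sum_increasingTuples_succ]
  refine sum_congr rfl fun y hy => ?_
  rw [tupleSum, mul_sum, sum_mul]
  refine sum_congr rfl fun x hx => ?_
  rw [gapWeight_snoc u hx (by simpa [Nat.lt_succ_iff] using hy), Fin.prod_univ_castSucc]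
  simp only [Fin.snoc_castSucc, Fin.snoc_last]
  ring

/-- The generating function of `tupleSum d u`. -/
noncomputable def tupleSeries {k : ℕ} (d : Fin k → ℕ) (u : ℕ → A) : A⟦X⟧ :=
  PowerSeries.mk (tupleSum d u)

lemma tupleSeries_zero (d : Fin 0 → ℕ) (u : ℕ → A) : tupleSeries d u = geomSeries (u 0) := by
  ext n
  simp [tupleSeries, tupleSum, increasingTuples_zero, gapWeight, position, coeff_geomSeries]

lemma coeff_succWeight_pow (F : A⟦X⟧) (e n : ℕ) :
    PowerSeries.coeff n ((succWeight ^ e) F) = (n + 1) ^ e * PowerSeries.coeff n F := by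
  induction e with
  | zero => simp
  | succ e ih => rw [pow_succ', Module.End.mul_apply, coeff_succWeight, ih, pow_succ', mul_assoc]

lemma tupleSeries_succ {k : ℕ} (d : Fin (k + 1) → ℕ) (u : ℕ → A) :
    tupleSeries d u = PowerSeries.X * geomSeries (u (k + 1)) *
      (succWeight ^ d (Fin.last k)) (tupleSeries (fun j => d j.castSucc) u) := by
  ext n
  cases n with
  | zero => simp [tupleSeries, tupleSum, sum_increasingTuples_succ, mul_assoc]
  | succ n =>
    rw [mul_assoc, PowerSeries.coeff_succ_X_mul, mul_comm (geomSeries _), PowerSeries.coeff_mul,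
      Nat.sum_antidiagonal_eq_sum_range_succ_mk, tupleSeries, PowerSeries.coeff_mk, tupleSum_succ]
    simp only [coeff_succWeight_pow, coeff_geomSeries, tupleSeries, PowerSeries.coeff_mk]

lemma tupleSeries_mem_rationalSeries {k l : ℕ} {u : ℕ → ℚ[X]} (d : Fin k → ℕ)
    (hu₀ : ∃ b ≤ l, u 0 = X - (b : ℚ[X])) (hu : ∀ i, u i = 0 ∨ ∃ b ≤ l, u i = X - (b : ℚ[X])) :
    tupleSeries d u ∈ rationalSeries l k k (∑ j, d j) := by
  induction k with
  | zero =>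
    obtain ⟨b, hb, hu₀⟩ := hu₀
    rw [tupleSeries_zero, hu₀, sum_of_isEmpty]
    exact geomSeries_mem_rationalSeries hb
  | succ k ih =>
    have mem := succWeight_pow_mem_rationalSeries (ih fun j => d j.castSucc) (d (Fin.last k))
    rw [tupleSeries_succ, Fin.sum_univ_castSucc]
    rcases hu (k + 1) with h | ⟨b, hb, h⟩ <;> rw [h]
    · rw [geomSeries_zero, mul_one]
      exact X_mul_mem_rationalSeries mem
    · exact rationalSeries_mono k.le_succ le_rfl le_rfl
        (X_mul_geomSeries_mul_mem_rationalSeries hb k.le_succ mem)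

lemma tupleSeries_mem_rationalSeries_sub_one {k l : ℕ} {u : ℕ → ℚ[X]} (d : Fin k → ℕ)
    (hu₀ : ∃ b ≤ l, u 0 = X - (b : ℚ[X])) (hu : ∀ i, u i = 0 ∨ ∃ b ≤ l, u i = X - (b : ℚ[X]))
    (hk : ∃ b ≤ l, u k = X - (b : ℚ[X])) :
    tupleSeries d u ∈ rationalSeries l (k - 1) k (∑ j, d j) := by
  cases k with
  | zero => exact tupleSeries_mem_rationalSeries d hu₀ hu
  | succ k =>
    obtain ⟨b, hb, hk⟩ := hk
    rw [tupleSeries_succ, Fin.sum_univ_castSucc, hk]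
    exact X_mul_geomSeries_mul_mem_rationalSeries hb k.le_succ
      (succWeight_pow_mem_rationalSeries (tupleSeries_mem_rationalSeries _ hu₀ hu) _)

end TupleSeries

section Colorings

variable {n : ℕ} {α : Type*} [DecidableEq α]

/-- The block of `i`, as an element of the set of blocks of `l`. -/
def block (l : SetPartition n) (i : Fin n) : l.parts :=
  ⟨l.part i, l.part_mem.2 (mem_univ i)⟩

lemma rel_iff_block_eq (l : SetPartition n) (i j : Fin n) : Rel l i j ↔ block l i = block l j := by
  rw [block, block, Subtype.mk.injEq,
    ← Finpartition.mem_part_iff_part_eq_part _ (mem_univ _) (mem_univ _),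
    Finpartition.mem_part_iff_exists]
  rfl

lemma block_surjective (l : SetPartition n) : Function.Surjective (block l) := by
  rintro ⟨b, hb⟩
  obtain ⟨i, hi⟩ := l.nonempty_of_mem_parts hb
  exact ⟨i, Subtype.ext (l.part_eq_of_mem hb hi)⟩

lemma eq_of_forall_rel_iff {l l' : SetPartition n} (h : ∀ i j, Rel l i j ↔ Rel l' i j) :
    l = l' := by
  have part_eq (i : Fin n) : l.part i = l'.part i := by
    ext j
    rw [Finpartition.mem_part_iff_exists, Finpartition.mem_part_iff_exists]
    exact h j i
  have parts_subset {l l' : SetPartition n} (h : ∀ i, l.part i = l'.part i) :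
      l.parts ⊆ l'.parts := fun b hb => by
    obtain ⟨i, hi⟩ := l.nonempty_of_mem_parts hb
    rw [← l.part_eq_of_mem hb hi, h i]
    exact l'.part_mem.2 (mem_univ i)
  exact Finpartition.ext ((parts_subset part_eq).antisymm (parts_subset fun i => (part_eq i).symm))

/-- The partition of `[n]` into the fibres of a coloring. -/
def kerPartition (φ : Fin n → α) : SetPartition n :=
  letI : DecidableRel (Setoid.ker φ).r := fun i j => decEq (φ i) (φ j)
  Finpartition.ofSetoid (Setoid.ker φ)

lemma rel_kerPartition (φ : Fin n → α) (i j : Fin n) :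
    Rel (kerPartition φ) i j ↔ φ i = φ j := by
  let : DecidableRel (Setoid.ker φ).r := fun i j => decEq (φ i) (φ j)
  have : Rel (kerPartition φ) i j ↔ i ∈ (kerPartition φ).part j := by
    rw [Finpartition.mem_part_iff_exists]
    rfl
  rw [this, eq_comm]
  exact Finpartition.mem_part_ofSetoid_iff_rel

lemma kerPartition_eq_iff_forall {l : SetPartition n} {φ : Fin n → α} :
    kerPartition φ = l ↔ ∀ i j, φ i = φ j ↔ Rel l i j := by
  constructor
  · rintro rfl i j
    exact (rel_kerPartition φ i j).symm
  · exact fun h => eq_of_forall_rel_iff fun i j => (rel_kerPartition φ i j).trans (h i j)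

lemma kerPartition_eq_iff_exists_embedding {l : SetPartition n} {φ : Fin n → α} :
    kerPartition φ = l ↔ ∃ e : l.parts ↪ α, φ = e ∘ block l := by
  simp only [kerPartition_eq_iff_forall, rel_iff_block_eq]
  constructor
  · intro h
    have block_inv := Function.surjInv_eq (block_surjective l)
    refine ⟨⟨φ ∘ Function.surjInv (block_surjective l), fun b b' hbb => ?_⟩, ?_⟩
    · rw [← block_inv b, ← block_inv b', ← h]
      exact hbb
    · funext i
      exact (h _ _).2 (block_inv _).symm
  · rintro ⟨e, rfl⟩ i j
    exact e.injective.eq_iff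

lemma card_kerPartition_eq (l : SetPartition n) (m : ℕ) :
    #{φ : Fin n → Fin m | kerPartition φ = l} = m.descFactorial #l.parts := by
  have colorings_eq : ({φ : Fin n → Fin m | kerPartition φ = l} : Finset _)
      = univ.image fun e : l.parts ↪ Fin m => e ∘ block l := by
    ext φ
    rw [mem_filter_univ, kerPartition_eq_iff_exists_embedding]
    simp [eq_comm]
  rw [colorings_eq, card_image_of_injective, card_univ, Fintype.card_embedding_eq, Fintype.card_coe,
    Fintype.card_fin]
  exact (block_surjective l).injective_comp_right.comp DFunLike.coe_injective

lemma card_filter_eq_bellFunctional {p : SetPartition n → Prop} [DecidablePred p] {g : ℚ[X]}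
    (h : ∀ m : ℕ, (#{φ : Fin n → Fin m | p (kerPartition φ)} : ℚ) = g.eval (m : ℚ)) :
    (#{l | p l} : ℚ) = bellFunctional ℚ g := by
  have g_eq : g = ∑ l with p l, descPochhammer ℚ #l.parts := by
    refine eq_of_infinite_eval_eq _ _ ((Set.infinite_range_of_injective
      (Nat.cast_injective (R := ℚ))).mono ?_)
    rintro _ ⟨m, rfl⟩
    rw [Set.mem_ofPred_eq, ← h, eval_finsetSum,
      card_eq_sum_card_fiberwise (f := kerPartition) (t := {l | p l}) (by intro φ; simp),
      Nat.cast_sum]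
    refine sum_congr rfl fun l hl => ?_
    rw [descPochhammer_eval_eq_descFactorial, ← card_kerPartition_eq l m, filter_filter]
    congr 2
    ext φ
    simp only [mem_filter_univ, and_iff_right_iff_imp]
    rintro rfl
    exact (mem_filter.1 hl).2
  simp [g_eq, bellFunctional_descPochhammer]

end Colorings

section Occurrences

section Position

variable {α : Type*} [LinearOrder α] {k : ℕ} {s : Fin k → α}

lemma lt_iff_lt_position (hs : StrictMono s) (e : Fin k) (y : α) :
    s e < y ↔ (e : ℕ) < position s y := by
  constructor
  · intro h
    rw [← Nat.succ_le_iff, Nat.succ_eq_add_one, ← Fin.card_Iic]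
    refine card_le_card fun i hi => ?_
    exact (mem_filter_univ _).2 ((hs.monotone (mem_Iic.1 hi)).trans_lt h)
  · contrapose!
    intro h
    rw [← Fin.card_Iio]
    refine card_le_card fun i hi => ?_
    exact mem_Iio.2 (hs.lt_iff_lt.1 (((mem_filter_univ _).1 hi).trans_le h))

lemma lt_iff_position_le (hs : StrictMono s) (e : Fin k) {y : α} (hy : y ∉ Set.range s) :
    y < s e ↔ position s y ≤ e := by
  rw [← not_lt, ← lt_iff_lt_position hs, not_lt]
  exact ⟨le_of_lt, fun h => h.lt_of_ne fun h => hy ⟨e, h.symm⟩⟩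

end Position

lemma forall_iff_forall_range {ι β : Type*} (s : ι → β) {p : β → Prop} :
    (∀ y, p y) ↔ (∀ i, p (s i)) ∧ ∀ y ∉ Set.range s, p y := by
  refine ⟨fun h => ⟨fun i => h _, fun y _ => h y⟩, fun h y => ?_⟩
  by_cases hy : y ∈ Set.range s
  · obtain ⟨i, rfl⟩ := hy
    exact h.1 i
  · exact h.2 y hy

section Restriction

variable {k n : ℕ} {l : SetPartition n} {l' : SetPartition k} {s : Fin k → Fin n}

lemma isFirst_map_iff (hs : StrictMono s) (hrel : ∀ i j, Rel l (s i) (s j) ↔ Rel l' i j)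
    (i : Fin k) :
    IsFirst l (s i) ↔ IsFirst l' i ∧ ∀ y ∉ Set.range s, y < s i → ¬ Rel l (s i) y := by
  rw [IsFirst, forall_iff_forall_range s, IsFirst]
  simp only [hrel, hs.le_iff_le]
  exact and_congr_right fun _ => forall₂_congr fun y _ => by rw [← not_lt, imp_not_comm]

lemma isLast_map_iff (hs : StrictMono s) (hrel : ∀ i j, Rel l (s i) (s j) ↔ Rel l' i j)
    (i : Fin k) :
    IsLast l (s i) ↔ IsLast l' i ∧ ∀ y ∉ Set.range s, s i < y → ¬ Rel l (s i) y := by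
  rw [IsLast, forall_iff_forall_range s, IsLast]
  simp only [hrel, hs.le_iff_le]
  exact and_congr_right fun _ => forall₂_congr fun y _ => by rw [← not_lt, imp_not_comm]

lemma isArc_map_iff (hs : StrictMono s) (hrel : ∀ i j, Rel l (s i) (s j) ↔ Rel l' i j)
    (i j : Fin k) :
    IsArc l (s i) (s j) ↔
      IsArc l' i j ∧ ∀ y ∉ Set.range s, s i < y → y < s j → ¬ Rel l (s i) y := by
  rw [IsArc, forall_iff_forall_range s, IsArc]
  simp only [hrel, hs.le_iff_le, hs.lt_iff_lt, and_assoc]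
  refine and_congr_right fun _ => and_congr_right fun _ => and_congr_right fun _ =>
    forall₂_congr fun y _ => ?_
  rw [← not_lt]
  tauto

lemma covBy_map_iff (hs : StrictMono s) (i j : Fin k) :
    s i ⋖ s j ↔ i ⋖ j ∧ ∀ y ∉ Set.range s, ¬ (s i < y ∧ y < s j) := by
  rw [CovBy, forall_iff_forall_range s, CovBy]
  simp only [hs.lt_iff_lt, and_assoc, not_and]

lemma abs_sub_eq_one_iff_covBy (x y : Fin n) :
    |((x : ℕ) : ℤ) - ((y : ℕ) : ℤ)| = 1 ↔ x ⋖ y ∨ y ⋖ x := by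
  rw [Fin.covBy_iff, Fin.covBy_iff, Nat.covBy_iff_add_one_eq, Nat.covBy_iff_add_one_eq,
    abs_eq zero_le_one]
  omega

end Restriction

variable {k n : ℕ} {P : Pattern k} {l : SetPartition n} {s : Fin k → Fin n}

/-- The pattern occurs in its own partition: the conditions imposed by `F`, `L`, `A` and `C` hold
there. Inconsistent patterns have no occurrences. -/
structure Pattern.IsConsistent (P : Pattern k) : Prop where
  isFirst : ∀ i ∈ P.firsts, IsFirst P.partition i
  isLast : ∀ i ∈ P.lasts, IsLast P.partition i
  isArc : ∀ p ∈ P.arcs, IsArc P.partition p.1 p.2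
  consec : ∀ p ∈ P.consec, p.1 ⋖ p.2 ∨ p.2 ⋖ p.1

/-- The adjacency conditions of the pattern exclude all points with `p` entries to their left,
other than the entries themselves. -/
def Pattern.IsClosedGap (P : Pattern k) (p : ℕ) : Prop :=
  ∃ q ∈ P.consec, (q.1 : ℕ) < p ∧ p ≤ q.2 ∨ (q.2 : ℕ) < p ∧ p ≤ q.1

open Classical in
/-- The entries of the pattern whose blocks may not contain a point with `p` entries to its left,
other than the entries themselves. -/
noncomputable def Pattern.forbidden (P : Pattern k) (p : ℕ) : Finset (Fin k) :=
  {e | (e ∈ P.firsts ∧ p ≤ e) ∨ (e ∈ P.lasts ∧ (e : ℕ) < p) ∨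
    ∃ e', (e, e') ∈ P.arcs ∧ (e : ℕ) < p ∧ p ≤ e'}

lemma Pattern.isClosedGap_position_iff (hs : StrictMono s) {y : Fin n} (hy : y ∉ Set.range s) :
    P.IsClosedGap (position s y) ↔
      ∃ q ∈ P.consec, s q.1 < y ∧ y < s q.2 ∨ s q.2 < y ∧ y < s q.1 := by
  simp only [IsClosedGap, lt_iff_position_le hs _ hy, lt_iff_lt_position hs]

lemma Pattern.mem_forbidden_position_iff (hs : StrictMono s) {y : Fin n} (hy : y ∉ Set.range s)
    {e : Fin k} :
    e ∈ P.forbidden (position s y) ↔ (e ∈ P.firsts ∧ y < s e) ∨ (e ∈ P.lasts ∧ s e < y) ∨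
      ∃ e', (e, e') ∈ P.arcs ∧ s e < y ∧ y < s e' := by
  simp only [forbidden, mem_filter_univ, lt_iff_position_le hs _ hy, lt_iff_lt_position hs]

lemma isOccurrence_iff (hs : StrictMono s) :
    IsOccurrence P l s ↔ P.IsConsistent ∧ (∀ i j, Rel l (s i) (s j) ↔ Rel P.partition i j) ∧
      ∀ y ∉ Set.range s, ¬ P.IsClosedGap (position s y) ∧
        ∀ e ∈ P.forbidden (position s y), ¬ Rel l (s e) y := by
  constructor
  · intro h
    have first i hi := (isFirst_map_iff hs h.rel_iff i).1 (h.isFirst i hi)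
    have last i hi := (isLast_map_iff hs h.rel_iff i).1 (h.isLast i hi)
    have arc p hp := (isArc_map_iff hs h.rel_iff p.1 p.2).1 (h.isArc p hp)
    have consec p hp := (abs_sub_eq_one_iff_covBy _ _).1 (h.consec p hp)
    simp only [covBy_map_iff hs] at consec
    refine ⟨⟨fun i hi => (first i hi).1, fun i hi => (last i hi).1, fun p hp => (arc p hp).1,
      fun p hp => (consec p hp).imp And.left And.left⟩, h.rel_iff, fun y hy => ⟨?_, ?_⟩⟩
    · rw [Pattern.isClosedGap_position_iff hs hy]
      rintro ⟨q, hq, hyq⟩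
      rcases consec q hq with ⟨hlt, hq⟩ | ⟨hlt, hq⟩
      · exact hyq.elim (hq y hy) fun hyq => (hyq.1.trans hyq.2).not_gt (hs hlt.lt)
      · exact hyq.elim (fun hyq => (hyq.1.trans hyq.2).not_gt (hs hlt.lt)) (hq y hy)
    · intro e he
      rw [Pattern.mem_forbidden_position_iff hs hy] at he
      rcases he with ⟨he, hlt⟩ | ⟨he, hlt⟩ | ⟨e', he, hlt⟩
      · exact (first e he).2 y hy hlt
      · exact (last e he).2 y hy hlt
      · exact (arc _ he).2 y hy hlt.1 hlt.2
  · rintro ⟨hP, hrel, h⟩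
    have closed {y} (hy : y ∉ Set.range s) :=
      (Pattern.isClosedGap_position_iff hs hy).not.1 (h y hy).1
    have forbidden {y} (hy : y ∉ Set.range s) {e} he :=
      (h y hy).2 e ((Pattern.mem_forbidden_position_iff hs hy).2 he)
    refine ⟨hs, hrel, fun i hi => ?_, fun i hi => ?_, fun p hp => ?_, fun p hp => ?_⟩
    · exact (isFirst_map_iff hs hrel i).2
        ⟨hP.isFirst i hi, fun y hy hlt => forbidden hy (Or.inl ⟨hi, hlt⟩)⟩
    · exact (isLast_map_iff hs hrel i).2
        ⟨hP.isLast i hi, fun y hy hlt => forbidden hy (Or.inr (Or.inl ⟨hi, hlt⟩))⟩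
    · exact (isArc_map_iff hs hrel p.1 p.2).2 ⟨hP.isArc p hp, fun y hy hlt hlt' =>
        forbidden hy (Or.inr (Or.inr ⟨p.2, hp, hlt, hlt'⟩))⟩
    · rw [abs_sub_eq_one_iff_covBy, covBy_map_iff hs, covBy_map_iff hs]
      exact (hP.consec p hp).imp (fun hcov => ⟨hcov, fun y hy hlt => closed hy ⟨p, hp, Or.inl hlt⟩⟩)
        fun hcov => ⟨hcov, fun y hy hlt => closed hy ⟨p, hp, Or.inr hlt⟩⟩

end Occurrences

section CountingOccurrences

lemma val_mem_range_val_iff {k n : ℕ} {s : Fin k → Fin n} {y : Fin n} :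
    (y : ℕ) ∈ Set.range (fun i => (s i : ℕ)) ↔ y ∈ Set.range s := by
  simp only [Set.mem_range, Fin.ext_iff]

lemma card_extensions {ι β γ : Type*} [Fintype β] [DecidableEq β] [Fintype γ] {s : ι → β}
    (hs : Function.Injective s) (ψ : ι → γ) (S : β → Finset γ) [DecidablePred (· ∈ Set.range s)]
    [DecidablePred fun φ : β → γ => φ ∘ s = ψ ∧ ∀ y ∉ Set.range s, φ y ∈ S y] :
    #{φ : β → γ | φ ∘ s = ψ ∧ ∀ y ∉ Set.range s, φ y ∈ S y}
      = ∏ y, if y ∈ Set.range s then 1 else #(S y) := by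
  have extensions_eq : ({φ : β → γ | φ ∘ s = ψ ∧ ∀ y ∉ Set.range s, φ y ∈ S y} : Finset _)
      = Fintype.piFinset fun y => if h : y ∈ Set.range s then {ψ h.choose} else S y := by
    ext φ
    rw [mem_filter_univ, Fintype.mem_piFinset, funext_iff]
    refine Iff.trans ?_ (forall_iff_forall_range s).symm
    refine and_congr (forall_congr' fun i => ?_) (forall₂_congr fun y hy => by rw [dif_neg hy])
    have hi : s i ∈ Set.range s := ⟨i, rfl⟩
    rw [dif_pos hi, mem_singleton, hs hi.choose_spec, Function.comp_apply]
  rw [extensions_eq, Fintype.card_piFinset]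
  refine prod_congr rfl fun y _ => ?_
  split_ifs <;> simp

variable {k n m : ℕ} {P : Pattern k} {s : Fin k → Fin n}

/-- The number of blocks of the pattern that may not contain a point with `p` entries to its
left, other than the entries themselves. -/
noncomputable def Pattern.numForbidden (P : Pattern k) (p : ℕ) : ℕ :=
  #((P.forbidden p).image (block P.partition))

lemma Pattern.numForbidden_le (P : Pattern k) (p : ℕ) :
    P.numForbidden p ≤ #P.partition.parts :=
  (card_le_univ _).trans_eq (Fintype.card_coe _)

open Classical in
/-- The number of colors available to a point with `p` entries of the pattern to its left, as a
polynomial in the number of all colors. -/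
noncomputable def Pattern.gapFactor (P : Pattern k) (p : ℕ) : ℚ[X] :=
  if P.IsClosedGap p then 0 else X - (P.numForbidden p : ℚ[X])

open Classical in
/-- The colors available to a point with `p` entries of the pattern to its left, when the entries
themselves are colored by `ψ`. -/
noncomputable def Pattern.availableColors (P : Pattern k) (ψ : Fin k → Fin m) (p : ℕ) :
    Finset (Fin m) :=
  {c | ¬ P.IsClosedGap p ∧ ∀ e ∈ P.forbidden p, ψ e ≠ c}

lemma Pattern.card_availableColors {ψ : Fin k → Fin m} (hψ : kerPartition ψ = P.partition)
    (p : ℕ) : (#(P.availableColors ψ p) : ℚ) = (P.gapFactor p).eval (m : ℚ) := by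
  by_cases hp : P.IsClosedGap p
  · simp [availableColors, gapFactor, hp]
  obtain ⟨e, he⟩ := kerPartition_eq_iff_exists_embedding.1 hψ
  have card_image : #((P.forbidden p).image ψ) = P.numForbidden p := by
    rw [numForbidden, he, ← image_image, card_image_of_injective _ e.injective]
  have availableColors_eq : P.availableColors ψ p = ((P.forbidden p).image ψ)ᶜ := by
    ext c
    simp [availableColors, hp]
  have card_le : P.numForbidden p ≤ m := card_image ▸ card_finset_fin_le _
  rw [availableColors_eq, card_compl, Fintype.card_fin, card_image, Nat.cast_sub card_le, gapFactor,
    if_neg hp, eval_sub, eval_X, eval_natCast]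

lemma isOccurrence_kerPartition_iff (hP : P.IsConsistent) (hs : StrictMono s)
    (φ : Fin n → Fin m) :
    IsOccurrence P (kerPartition φ) s ↔ kerPartition (φ ∘ s) = P.partition ∧
      ∀ y ∉ Set.range s, φ y ∈ P.availableColors (φ ∘ s) (position s y) := by
  simp only [isOccurrence_iff hs, hP, true_and, rel_kerPartition, kerPartition_eq_iff_forall,
    Function.comp_apply, Pattern.availableColors, mem_filter_univ, ne_eq]

open Classical in
lemma card_isOccurrence_kerPartition_comp_eq (hP : P.IsConsistent) (hs : StrictMono s)
    {ψ : Fin k → Fin m} (hψ : kerPartition ψ = P.partition) :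
    (#{φ : Fin n → Fin m | IsOccurrence P (kerPartition φ) s ∧ φ ∘ s = ψ} : ℚ)
      = (gapWeight P.gapFactor (fun i => (s i : ℕ)) n).eval (m : ℚ) := by
  have extension_iff (φ : Fin n → Fin m) : IsOccurrence P (kerPartition φ) s ∧ φ ∘ s = ψ ↔
      φ ∘ s = ψ ∧ ∀ y ∉ Set.range s, φ y ∈ P.availableColors ψ (position s y) := by
    rw [isOccurrence_kerPartition_iff hP hs]
    constructor
    · rintro ⟨⟨-, h⟩, rfl⟩
      exact ⟨rfl, h⟩
    · rintro ⟨rfl, h⟩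
      exact ⟨⟨hψ, h⟩, rfl⟩
  simp only [extension_iff]
  rw [card_extensions hs.injective ψ fun y => P.availableColors ψ (position s y), gapWeight,
    prod_range, eval_prod, Nat.cast_prod]
  refine prod_congr rfl fun y _ => ?_
  simp only [val_mem_range_val_iff]
  split_ifs
  · simp
  · exact Pattern.card_availableColors hψ _

open Classical in
lemma card_isOccurrence_kerPartition (hP : P.IsConsistent) (hs : StrictMono s) (m : ℕ) :
    (#{φ : Fin n → Fin m | IsOccurrence P (kerPartition φ) s} : ℚ)
      = (descPochhammer ℚ #P.partition.parts
          * gapWeight P.gapFactor (fun i => (s i : ℕ)) n).eval (m : ℚ) := by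
  have mapsTo : ∀ φ ∈ ({φ : Fin n → Fin m | IsOccurrence P (kerPartition φ) s} : Finset _),
      φ ∘ s ∈ ({ψ : Fin k → Fin m | kerPartition ψ = P.partition} : Finset _) := fun φ hφ =>
    (mem_filter_univ (φ ∘ s)).2
      ((isOccurrence_kerPartition_iff hP hs φ).1 ((mem_filter_univ φ).1 hφ)).1
  rw [card_eq_sum_card_fiberwise mapsTo, eval_mul, descPochhammer_eval_eq_descFactorial,
    ← card_kerPartition_eq, Nat.cast_sum, ← nsmul_eq_mul, ← sum_const]
  refine sum_congr rfl fun ψ hψ => ?_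
  rw [filter_filter]
  exact card_isOccurrence_kerPartition_comp_eq hP hs ((mem_filter_univ ψ).1 hψ)

open Classical in
lemma card_isOccurrence (hP : P.IsConsistent) (hs : StrictMono s) :
    (#{l : SetPartition n | IsOccurrence P l s} : ℚ) = bellFunctional ℚ
      (descPochhammer ℚ #P.partition.parts * gapWeight P.gapFactor (fun i => (s i : ℕ)) n) :=
  card_filter_eq_bellFunctional fun m => card_isOccurrence_kerPartition hP hs m

lemma Pattern.gapFactor_eq_zero_or (P : Pattern k) (p : ℕ) :
    P.gapFactor p = 0 ∨ ∃ b ≤ #P.partition.parts, P.gapFactor p = X - (b : ℚ[X]) := by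
  rw [gapFactor]
  split_ifs
  · exact Or.inl rfl
  · exact Or.inr ⟨_, P.numForbidden_le p, rfl⟩

lemma Pattern.exists_gapFactor_eq (P : Pattern k) {p : ℕ} (hp : ¬ P.IsClosedGap p) :
    ∃ b ≤ #P.partition.parts, P.gapFactor p = X - (b : ℚ[X]) :=
  ⟨_, P.numForbidden_le p, if_neg hp⟩

lemma Pattern.not_isClosedGap_zero (P : Pattern k) : ¬ P.IsClosedGap 0 := by
  simp [IsClosedGap]

lemma Pattern.not_isClosedGap_length (P : Pattern k) : ¬ P.IsClosedGap k := by
  rintro ⟨q, -, h | h⟩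
  · exact h.2.not_gt q.2.2
  · exact h.2.not_gt q.1.2

lemma Pattern.tupleSeries_mem_rationalSeries (P : Pattern k) (d : Fin k → ℕ) :
    tupleSeries d P.gapFactor ∈ rationalSeries #P.partition.parts (k - 1) k (∑ j, d j) :=
  tupleSeries_mem_rationalSeries_sub_one d (P.exists_gapFactor_eq P.not_isClosedGap_zero)
    P.gapFactor_eq_zero_or (P.exists_gapFactor_eq P.not_isClosedGap_length)

end CountingOccurrences

section Aggregate

lemma sum_increasingTuples_eq {M : Type*} [AddCommMonoid M] {k n : ℕ} (F : (Fin k → ℕ) → M)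
    [DecidablePred (StrictMono : (Fin k → Fin n) → Prop)] :
    ∑ x ∈ increasingTuples k n, F x
      = ∑ s : Fin k → Fin n with StrictMono s, F fun i => (s i : ℕ) := by
  symm
  refine sum_bij (fun s _ i => (s i : ℕ)) (fun s hs => ?_) (fun s _ s' _ h => ?_) (fun x hx => ?_)
    fun _ _ => rfl
  · exact mem_increasingTuples.2 ⟨fun i => (s i).2, fun i j h => (mem_filter_univ s).1 hs h⟩
  · exact funext fun i => Fin.ext (congrFun h i)
  · obtain ⟨hlt, hmono⟩ := mem_increasingTuples.1 hx
    exact ⟨fun i => ⟨x i, hlt i⟩, (mem_filter_univ _).2 fun i j h => hmono h, rfl⟩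

lemma bellFunctional_mul_tupleSum {k : ℕ} (d : Fin k → ℕ) (u : ℕ → ℚ[X]) (q : ℚ[X]) (n : ℕ) :
    bellFunctional ℚ (q * tupleSum d u n) = ∑ x ∈ increasingTuples k n,
      (∏ j, (x j + 1 : ℚ) ^ d j) * bellFunctional ℚ (q * gapWeight u x n) := by
  rw [tupleSum, mul_sum, map_sum]
  refine sum_congr rfl fun x _ => ?_
  rw [← bellFunctional_C_mul, mul_left_comm]
  simp

open Classical in
lemma sum_value_eq_sum_card (σ : SimpleStatistic) (n : ℕ) :
    ∑ l : SetPartition n, (σ.value l : ℚ) = ∑ s : Fin σ.length → Fin n with StrictMono s,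
      (MvPolynomial.eval (fun v : Option (Fin σ.length) =>
          v.elim (n : ℤ) fun i => ((s i : ℕ) : ℤ) + 1) σ.poly : ℚ)
        * #{l : SetPartition n | IsOccurrence σ.pattern l s} := by
  simp only [SimpleStatistic.value, sum_filter, Int.cast_sum]
  rw [sum_comm]
  refine sum_congr rfl fun s _ => ?_
  split_ifs with hs
  · rw [card_filter, Nat.cast_sum, mul_sum]
    refine sum_congr rfl fun l _ => ?_
    split_ifs <;> simp
  · refine sum_eq_zero fun l _ => ?_
    rw [if_neg fun h => hs h.strictMono, Int.cast_zero]

lemma eval_eq_sum_prod {k : ℕ} (Q : MvPolynomial (Option (Fin k)) ℤ) (n : ℕ) (x : Fin k → ℕ) :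
    ((MvPolynomial.eval (fun v : Option (Fin k) =>
        v.elim (n : ℤ) fun i => (x i : ℤ) + 1) Q : ℤ) : ℚ)
      = ∑ μ ∈ Q.support, ((Q.coeff μ : ℤ) : ℚ) *
          ((n : ℚ) ^ μ none * ∏ j, (x j + 1 : ℚ) ^ μ (some j)) := by
  rw [MvPolynomial.eval_eq']
  simp [Fintype.prod_option]

lemma sum_value_eq_sum_bellFunctional (σ : SimpleStatistic) (hP : σ.pattern.IsConsistent) (n : ℕ) :
    ∑ l : SetPartition n, (σ.value l : ℚ) = ∑ μ ∈ σ.poly.support, ((σ.poly.coeff μ : ℤ) : ℚ) *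
      ((n : ℚ) ^ μ none * bellFunctional ℚ (descPochhammer ℚ #σ.pattern.partition.parts *
        tupleSum (fun j => μ (some j)) σ.pattern.gapFactor n)) := by
  classical
  simp only [bellFunctional_mul_tupleSum, sum_increasingTuples_eq, mul_sum]
  rw [sum_value_eq_sum_card, sum_comm]
  refine sum_congr rfl fun s hs => ?_
  rw [card_isOccurrence hP ((mem_filter_univ s).1 hs), eval_eq_sum_prod, sum_mul]
  simp only [mul_assoc]

lemma sum_value_eq_zero (σ : SimpleStatistic) (hP : ¬ σ.pattern.IsConsistent) (n : ℕ) :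
    ∑ l : SetPartition n, (σ.value l : ℚ) = 0 := by
  classical
  rw [sum_value_eq_sum_card]
  refine sum_eq_zero fun s hs => ?_
  rw [filter_false_of_mem fun l _ h =>
    hP ((isOccurrence_iff ((mem_filter_univ s).1 hs)).1 h).1, card_empty, Nat.cast_zero, mul_zero]

lemma Pattern.pow_mul_bellFunctional_mem_bellSequences {k : ℕ} (P : Pattern k) (d : Fin k → ℕ)
    (e : ℕ) :
    (fun n : ℕ => (n : ℚ) ^ e * bellFunctional ℚ
      (descPochhammer ℚ #P.partition.parts * tupleSum d P.gapFactor n))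
      ∈ bellSequences k (k + (∑ j, d j + e)) := by
  have card_parts_le : #P.partition.parts ≤ k := by
    simpa using P.partition.card_parts_le_card
  have mem := bellFunctional_coeff_mem_bellSequences card_parts_le le_rfl
    (P.tupleSeries_mem_rationalSeries d)
  simp only [tupleSeries, PowerSeries.coeff_mk] at mem
  rw [← add_assoc]
  exact natCast_pow_mul_mem_bellSequences mem e

lemma sum_add_le_totalDegree {k : ℕ} {Q : MvPolynomial (Option (Fin k)) ℤ}
    {μ : Option (Fin k) →₀ ℕ} (hμ : μ ∈ Q.support) :
    ∑ j, μ (some j) + μ none ≤ Q.totalDegree := by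
  refine le_trans (le_of_eq ?_) (MvPolynomial.le_totalDegree hμ)
  rw [Finsupp.sum_fintype _ _ fun _ => rfl, Fintype.sum_option, add_comm]

lemma sum_value_mem_bellSequences (σ : SimpleStatistic) :
    (fun n => ∑ l : SetPartition n, (σ.value l : ℚ)) ∈ bellSequences σ.length σ.degree := by
  by_cases hP : σ.pattern.IsConsistent
  · simp only [sum_value_eq_sum_bellFunctional σ hP]
    rw [← Finset.sum_fn]
    refine Submodule.sum_mem _ fun μ hμ => Submodule.smul_mem _ ((σ.poly.coeff μ : ℤ) : ℚ) ?_
    exact bellSequences_mono le_rfl (Nat.add_le_add_left (sum_add_le_totalDegree hμ) _)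
      (σ.pattern.pow_mul_bellFunctional_mem_bellSequences (fun j => μ (some j)) (μ none))
  · simp only [sum_value_eq_zero σ hP]
    exact zero_mem (bellSequences σ.length σ.degree)

lemma aggregate_mem_bellSequences {f : (n : ℕ) → SetPartition n → ℚ} {c : SimpleStatistic →₀ ℚ}
    (hc : Represents c f) : aggregate f ∈ bellSequences (maxLength c) (maxDegree c) := by
  have aggregate_eq : aggregate f
      = ∑ σ ∈ c.support, c σ • fun n => ∑ l : SetPartition n, (σ.value l : ℚ) := by
    funext n
    rw [aggregate, sum_congr rfl fun l _ => hc n l, Finset.sum_apply]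
    simp only [Finsupp.sum, Pi.smul_apply, smul_eq_mul, mul_sum]
    exact sum_comm
  rw [aggregate_eq]
  exact Submodule.sum_mem _ fun σ hσ => Submodule.smul_mem _ _
    (bellSequences_mono (le_sup (f := SimpleStatistic.length) hσ)
      (le_sup (f := SimpleStatistic.degree) hσ) (sum_value_mem_bellSequences σ))

lemma exists_represents_maxDegree_eq_degree {f : (n : ℕ) → SetPartition n → ℚ}
    {c : SimpleStatistic →₀ ℚ} (hc : Represents c f) :
    ∃ c' : SimpleStatistic →₀ ℚ, Represents c' f ∧ maxDegree c' = degree f :=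
  Nat.sInf_mem (s := {d | ∃ c : SimpleStatistic →₀ ℚ, Represents c f ∧ maxDegree c = d})
    ⟨_, c, hc, rfl⟩

end Aggregate

end SetPartitionStat

theorem theorem2p2
    (f : (n : ℕ) → SetPartitionStat.SetPartition n → ℚ)
    (c : SetPartitionStat.SimpleStatistic →₀ ℚ)
    (hc : SetPartitionStat.Represents c f) :
    ∃ R : SetPartitionStat.ShiftedBellPolynomial,
      (∀ n : ℕ, 1 ≤ n → SetPartitionStat.maxLength c ≤ n + 1 →
        SetPartitionStat.aggregate f n = SetPartitionStat.evalAt R n) ∧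
      (∀ j ∈ R.support, j ≤ (SetPartitionStat.degree f : ℤ)) ∧
      (∀ j ∈ R.support, -(SetPartitionStat.maxLength c : ℤ) ≤ j) ∧
      (∀ j : ℕ, j ≤ SetPartitionStat.degree f →
        (R ((SetPartitionStat.degree f : ℤ) - (j : ℤ))).natDegree ≤ j) ∧
      (∀ j : ℕ, SetPartitionStat.degree f < j →
        (R ((SetPartitionStat.degree f : ℤ) - (j : ℤ))).natDegree ≤ j - 1) := by
  obtain ⟨c', hc', hdegree⟩ := SetPartitionStat.exists_represents_maxDegree_eq_degree hc
  obtain ⟨R, hR, eval_eq⟩ := SetPartitionStat.aggregate_mem_bellSequences hc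
  obtain ⟨R', hR', eval_eq'⟩ := SetPartitionStat.aggregate_mem_bellSequences hc'
  obtain rfl : R = R' := SetPartitionStat.eq_of_evalAt_eventually_eq
    (n₀ := SetPartitionStat.maxLength c + SetPartitionStat.maxLength c') fun n hn => by
      rw [← eval_eq n (by omega), ← eval_eq' n (by omega)]
  rw [hdegree] at hR'
  refine ⟨R, fun n _ hn => eval_eq n hn, fun j hj => ?_, fun j hj => (hR j hj).1,
    fun j _ => SetPartitionStat.natDegree_le_of_mem_boundedBell hR' j,
    fun j hj => Nat.le_sub_one_of_lt (SetPartitionStat.natDegree_lt_of_mem_boundedBell hR' hj)⟩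
  have := (hR' j hj).2.1
  omega
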